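/- **Setting.** Write $e(x)=e^{2\pi i x}$, $M_\nu T_t u(x)=e(\nu x)\,u(x-t)$. A stochastic operator $\mathbf H$ is given by $\mathbf H u=\iint \boldsymbol\eta(t,\nu)\,M_\nu T_t u\,dt\,d\nu$ (in the weak sense, for distributions $u$), where the spreading function $\boldsymbol\eta$ is a zero-mean random process on $\mathbb R^2$ with paths in $L^2(\mathbb R^2)$ and finite mean energy $\mathbb E\|\boldsymbol\eta\|_{L^2(\mathbb R^2)}^2<\infty$. Put $R_{\boldsymbol\eta}(t,\nu;t',\nu')=\mathbb E\{\boldsymbol\eta(t,\nu)\overline{\boldsymbol\eta(t',\nu')}\}$. For a closed $U\subseteq\mathbb R^4$, $\mathbf H\in \mathrm{StOPW}(U)$ means that $\operatorname{supp}R_{\boldsymbol\eta}\subseteq U$ (essential support). Let $\Box=[0,a)\times[0,b)$ with $a,b>0$. The set $U$ is $(a,b,\Lambda)$-symmetrically rectified, where $\Lambda=\{(k_j,n_j,k'_j,n'_j)\}_{j=0}^{L^2-1}\subset\mathbb Z^4$ has $L^2$ elements, if $L$ is prime, $ab=1/L$, $U\subseteq\bigcup_j Q_j$ with $Q_j=\Box^2+(ak_j,bn_j,ak'_j,bn'_j)$,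 and $\bigcup_jQ_j$ is invariant under $(t,\nu;t',\nu')\mapsto(t',\nu';t,\nu)$. For $c\in\mathbb C^L$ (indices modulo $L$) let $G$ be the $L\times L^2$ Gabor matrix with entries $G_{p,(k,n)}=e(np/L)\,c_{p-k}$, $p,k,n\in\mathbb Z_L$, and let $(\overline G\otimes G)|_\Lambda$ be the $L^2\times L^2$ matrix whose entry in row $(p,p')$ and column $j$ is $G_{p,(k_j,n_j)}\,\overline{G_{p',(k'_j,n'_j)}}$ (lattice indices reduced modulo $L$). Let $Ш_c=\sum_{k\in\mathbb Z}c_{k\bmod L}\,\delta_{ak}$. **Theorem.** Let $U$ be $(a,b,\Lambda)$-symmetrically rectified, and suppose that, for some $c\in\mathbb C^L$, the matrix $(\overline G\otimes G)|_\Lambda$ has a left inverse $A=[\alpha_{j,p,p'}]$. Then for every $\mathbf H\in\mathrm{StOPW}(U)$ the response $\boldsymbol f=\mathbf HШ_c$ exists as a random process with locally integrable paths, $\boldsymbol f(x)$ has a finite second moment for almost every $x$, and $R_{\boldsymbol\eta}$ is recovered from $R_{\boldsymbol f}(x,x')=\mathbb E\{\boldsymbol f(x)\overline{\boldsymbol f(x')}\}$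 by $$ \begin{aligned} R_{\boldsymbol\eta}(t,\nu;t',\nu')={}&b^{-2}\sum_{j=0}^{L^2-1}\chi_{Q_j}(t,\nu;t',\nu')\sum_{p,p'=0}^{L-1}\alpha_{j,p,p'}\,e\big(ab(n_jp-n'_jp')\big)\\ &\times\sum_{m,m'\in\mathbb Z}e\big(-\nu x_{j,p,m}+\nu' x'_{j,p',m'}\big)\,R_{\boldsymbol f}\big(x_{j,p,m},\,x'_{j,p',m'}\big), \end{aligned} $$ where $x_{j,p,m}=t-a(k_j+mL-p)$, $x'_{j,p',m'}=t'-a(k'_j+m'L-p')$, $\chi_{Q_j}$ is the indicator function of $Q_j$, and the series over $(m,m')\in\mathbb Z^2$ converges unconditionally (along the finite subsets of $\mathbb Z^2$), the right-hand side converging to $R_{\boldsymbol\eta}$ in $L^2(\mathbb R^4)$. -/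

import Mathlib

open MeasureTheory Filter Topology
open scoped Kronecker

namespace OpSampling

noncomputable section

/-- A point `(t, ν)` of the time-frequency plane. -/
abbrev TF : Type := ℝ × ℝ

/-- A lattice index `((k, n), (k', n'))`. -/
abbrev Idx : Type := (ℤ × ℤ) × (ℤ × ℤ)

/-- `e x = exp (2 π i x)`. -/
def e (x : ℝ) : ℂ := Complex.exp (2 * Real.pi * Complex.I * (x : ℂ))

/-! ### Random processes and autocorrelation -/

/-- The autocorrelation `R_X (s, s') = E [X s * conj (X s')]` of a process `X` indexed by `T`. -/
def autocorr {Ω T : Type*} [MeasurableSpace Ω] (P : Measure Ω) (X : Ω → T → ℂ) (q : T × T) : ℂ :=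
  ∫ ω, X ω q.1 * star (X ω q.2) ∂P

/-- The class `StL²(ℝ²)`: zero-mean random processes with paths in `L²(ℝ²)` and with finite mean
energy `E ‖η‖² < ∞` (so that second moments exist). -/
structure IsStL2 {Ω : Type*} [MeasurableSpace Ω] (P : Measure Ω) (η : Ω → TF → ℂ) : Prop where
  path_memLp : ∀ ω, MemLp (η ω) 2 volume
  memLp : MemLp (fun q : Ω × TF => η q.1 q.2) 2 (P.prod volume)
  zero_mean : ∀ᵐ z : TF, ∫ ω, η ω z ∂P = 0

/-- The stochastic operator Paley-Wiener space `StOPW(U)`, an operator being represented by its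
stochastic spreading function `η`.  For a closed set `U`, the (essential) support of the
autocorrelation lies in `U` iff the autocorrelation vanishes almost everywhere off `U`. -/
def StOPW {Ω : Type*} [MeasurableSpace Ω] (P : Measure Ω) (U : Set (TF × TF)) :
    Set (Ω → TF → ℂ) :=
  {η | IsStL2 P η ∧ IsClosed U ∧ ∀ᵐ q : TF × TF, q ∉ U → autocorr P η q = 0}

/-! ### The action of an operator on a distribution -/

/-- A distribution, as a functional on test functions `φ`, paired bilinearly. -/
abbrev Functional : Type := (ℝ → ℂ) → ℂ

/-- The time-frequency shift `M_ν T_t u` of a distribution `u`, by duality.  For a function `u`,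
`∫ e (ν x) * u (x - t) * φ x dx = ∫ u x * (e (ν (x + t)) * φ (x + t)) dx`. -/
def tfShift (z : TF) (u : Functional) : Functional :=
  fun φ => u (fun x => e (z.2 * (x + z.1)) * φ (x + z.1))

/-- The `L`-periodic weighted delta train `Ш_c = ∑_{k ∈ ℤ} c_{k mod L} δ_{a k}`. -/
def deltaTrain {L : ℕ} (a : ℝ) (c : ZMod L → ℂ) : Functional :=
  fun φ => ∑' k : ℤ, c (k : ZMod L) * φ (a * k)

/-- `g = H u`, where `H u = ∬ η(t, ν) M_ν T_t u dt dν` is understood weakly, that is, tested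
against every smooth compactly supported `φ`. -/
structure IsResponse (η : TF → ℂ) (u : Functional) (g : ℝ → ℂ) : Prop where
  locallyIntegrable : LocallyIntegrable g volume
  integrable : ∀ φ : ℝ → ℂ, ContDiff ℝ (⊤ : ℕ∞) φ → HasCompactSupport φ →
    Integrable (fun z : TF => η z * tfShift z u φ) volume
  integral_eq : ∀ φ : ℝ → ℂ, ContDiff ℝ (⊤ : ℕ∞) φ → HasCompactSupport φ →
    ∫ x, g x * φ x = ∫ z : TF, η z * tfShift z u φ

/-- The random process `f = H u`, for a stochastic operator with spreading function `η`. -/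
structure IsStochResponse {Ω : Type*} [MeasurableSpace Ω] (P : Measure Ω) (η : Ω → TF → ℂ)
    (u : Functional) (f : Ω → ℝ → ℂ) : Prop where
  measurable : AEStronglyMeasurable (fun q : Ω × ℝ => f q.1 q.2) (P.prod volume)
  response : ∀ᵐ ω ∂P, IsResponse (η ω) u (f ω)

/-! ### Rectification -/

/-- The rectangle `[0, a) × [0, b)`. -/
def rect (a b : ℝ) : Set TF := Set.Ico 0 a ×ˢ Set.Ico 0 b

/-- The parallelepiped `rect × rect + (a k, b n, a k', b n')`. -/
def cell (a b : ℝ) (j : Idx) : Set (TF × TF) :=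
  {q | (q.1.1 - a * j.1.1, q.1.2 - b * j.1.2) ∈ rect a b ∧
       (q.2.1 - a * j.2.1, q.2.2 - b * j.2.2) ∈ rect a b}

/-- The union of the parallelepipeds indexed by `Λ`. -/
def cover (a b : ℝ) (Λ : Finset Idx) : Set (TF × TF) := ⋃ j ∈ Λ, cell a b j

/-- `U` is `(a, b, Λ)`-symmetrically rectified. -/
structure IsSymmRectified (a b : ℝ) (L : ℕ) (Λ : Finset Idx) (U : Set (TF × TF)) : Prop where
  a_pos : 0 < a
  b_pos : 0 < b
  prime : L.Prime
  area : a * b = 1 / (L : ℝ)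
  card : Λ.card = L ^ 2
  subset : U ⊆ cover a b Λ
  symm : ∀ z z' : TF, (z, z') ∈ cover a b Λ → (z', z) ∈ cover a b Λ

/-! ### Gabor matrices -/

/-- `T^k c [p] = c [p - k]`. -/
def finTrans {L : ℕ} (k : ZMod L) (c : ZMod L → ℂ) : ZMod L → ℂ := fun p => c (p - k)

/-- `M^n c [p] = exp (2 π i n p / L) c [p]`. -/
def finModul {L : ℕ} (n : ZMod L) (c : ZMod L → ℂ) : ZMod L → ℂ :=
  fun p => e ((n.val : ℝ) * p.val / L) * c p

/-- The `L × L²` Gabor matrix whose column `(k, n)` is `M^n T^k c`. -/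
def gabor {L : ℕ} (c : ZMod L → ℂ) : Matrix (ZMod L) (ZMod L × ZMod L) ℂ :=
  Matrix.of fun p kn => finModul kn.2 (finTrans kn.1 c) p

/-- The reduction modulo `L` of a lattice index `(k, n)`. -/
def modL (L : ℕ) (kn : ℤ × ℤ) : ZMod L × ZMod L := ((kn.1 : ZMod L), (kn.2 : ZMod L))

/-- The submatrix `(conj G ⊗ G)|_Λ`.  Rows are indexed by `(p', p)` and the column of
`j = ((k, n), (k', n'))` is the column `((k', n'), (k, n))` modulo `L` of `conj G ⊗ G`, in accordance
with column-stacking vectorization, `vec (G X G*) = (conj G ⊗ G) vec X`. -/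
def gaborTensor {L : ℕ} (c : ZMod L → ℂ) (Λ : Finset Idx) :
    Matrix (ZMod L × ZMod L) Λ ℂ :=
  (((gabor c).map star) ⊗ₖ (gabor c)).submatrix id (fun j => (modL L j.1.2, modL L j.1.1))

/-! ### The reconstruction formula -/

/-- The sampling point `t - a (k + m L - p)`. -/
def samplePt (a : ℝ) (L : ℕ) (t : ℝ) (k m : ℤ) (p : ZMod L) : ℝ :=
  t - a * ((k : ℝ) + m * L - p.val)

/-- The right-hand side of the reconstruction formula at `q = ((t, ν), (t', ν'))`, where the series
over `(m, m') ∈ ℤ²` is truncated to a finite set `F`, `R` stands for the autocorrelation of the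
response, and `α_{j, p, p'} = A j (p', p)`. -/
def reconPartial (a b : ℝ) {L : ℕ} [NeZero L] (Λ : Finset Idx)
    (A : Matrix Λ (ZMod L × ZMod L) ℂ) (R : ℝ × ℝ → ℂ) (F : Finset (ℤ × ℤ)) (q : TF × TF) : ℂ :=
  ((b : ℂ) ^ 2)⁻¹ * ∑ j : Λ, (cell a b j.1).indicator (fun _ => (1 : ℂ)) q *
    ∑ p : ZMod L, ∑ p' : ZMod L,
      A j (p', p) * e (a * b * (j.1.1.2 * p.val - j.1.2.2 * p'.val)) *
        ∑ m ∈ F,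
          e (-(q.1.2 * samplePt a L q.1.1 j.1.1.1 m.1 p
              - q.2.2 * samplePt a L q.2.1 j.1.2.1 m.2 p')) *
            R (samplePt a L q.1.1 j.1.1.1 m.1 p, samplePt a L q.2.1 j.1.2.1 m.2 p')

end

end OpSampling

open OpSampling

/-! The point is that all unknowns can be read off on cells, where `a * b * L = 1` turns time
samples into Fourier coefficients. Write a time as `s + a r` with `s ∈ [0, a)` and a frequency as `y
+ b n` with `y ∈ [0, b)`. If the spreading function lives on finitely many time-frequency cells `(k,
n)`, then only one delta reaches `s + a r` through each cell, and `f (s + a r) = ∑ c_{r-k} ∫_{[0,b)}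
e ((y + b n) (s + a r)) η (s + a k, y + b n) dy`. Taking the covariance of two such samples gives
`responseCorr`: a sum over `j ∈ Λ` of integrals of `R_η` over the frequency square of the cell `j`,
with both times fixed.

Put `r = p - m L`. By `phase_eq` the phase splits into `e (n p / L)`, which together with `c_{p-k}`
is a Gabor matrix entry, a character `e (-m y / b)`, a modulation independent of `m`, and an
integer. Hence for fixed `(p, p')` the series over `(m, m')` is the Fourier series on `[0, b)²` of a
combination of the cell pieces of `R_η`, with coefficients from `(conj G ⊗ G)|_Λ`, and the left
inverse isolates the cell `j`. The error of a partial sum is therefore exactly a finite sum of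
Fourier residuals (`sub_reconPartial`). These tend to zero on almost every time fibre, and Bessel's
inequality dominates them, so they tend to zero in `L²(ℝ⁴)` (`IsONB.tendsto_residual_prod`).

Existence of the response requires the paths themselves, not only `R_η`, to live on finitely many
cells. If `(l, l) ∉ Λ`, the autocorrelation vanishes on the diagonal block of the cell `l`, so every
pairing of the process with a function on that cell has zero second moment, and the process vanishes
there almost surely (`ae_eq_zero_of_autocorr`, `ae_eq_zero_off_cells`). Weak uniqueness
(`IsStochResponse.ae_eq`) carries the explicit formula over to every other version of the response.
-/

namespace OpSampling

noncomputable section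

/-! ### The character `e` -/

lemma e_add (x y : ℝ) : e (x + y) = e x * e y := by
  simp only [e, ← Complex.exp_add]
  congr 1
  push_cast
  ring

lemma e_zero : e 0 = 1 := by simp [e]

lemma norm_e (x : ℝ) : ‖e x‖ = 1 := by
  have : 2 * (Real.pi : ℂ) * Complex.I * (x : ℂ) = ((2 * Real.pi * x : ℝ) : ℂ) * Complex.I := by
    push_cast
    ring
  rw [e, this, Complex.norm_exp_ofReal_mul_I]

lemma e_neg_mul_self (x : ℝ) : e (-x) * e x = 1 := by
  rw [← e_add, neg_add_cancel, e_zero]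

lemma star_e (x : ℝ) : star (e x) = e (-x) := by
  simp only [e, Complex.star_def, ← Complex.exp_conj]
  congr 1
  simp [Complex.conj_ofNat]

lemma e_intCast (n : ℤ) : e n = 1 := by
  rw [e, Complex.exp_eq_one_iff]
  exact ⟨n, by push_cast; ring⟩

lemma e_add_int (x : ℝ) (n : ℤ) : e (x + n) = e x := by
  rw [e_add, e_intCast, mul_one]

lemma continuous_e : Continuous e := by
  unfold e
  fun_prop

lemma measurable_e : Measurable e := continuous_e.measurable

/-! ### Square-integrable functions -/

section L2

variable {α β : Type*} [MeasurableSpace α] [MeasurableSpace β]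

lemma eLpNorm_two_sq (f : α → ℂ) (μ : Measure α) :
    eLpNorm f 2 μ ^ 2 = ∫⁻ x, ‖f x‖ₑ ^ 2 ∂μ := by
  rw [eLpNorm_eq_lintegral_rpow_enorm_toReal (by norm_num) (by norm_num)]
  simp only [ENNReal.toReal_ofNat, ENNReal.rpow_ofNat, one_div]
  rw [← ENNReal.rpow_natCast, ← ENNReal.rpow_mul]
  simp

lemma memLp_two_iff {f : α → ℂ} {μ : Measure α} (hf : AEStronglyMeasurable f μ) :
    MemLp f 2 μ ↔ ∫⁻ x, ‖f x‖ₑ ^ 2 ∂μ < ⊤ := by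
  rw [← eLpNorm_two_sq]
  simp [MemLp, hf]

lemma _root_.MeasureTheory.MemLp.lintegral_sq_lt_top {f : α → ℂ} {μ : Measure α}
    (hf : MemLp f 2 μ) : ∫⁻ x, ‖f x‖ₑ ^ 2 ∂μ < ⊤ := (memLp_two_iff hf.1).1 hf

lemma lintegral_mul_sq_le {f g : α → ENNReal} {μ : Measure α} (hf : AEMeasurable f μ)
    (hg : AEMeasurable g μ) :
    (∫⁻ x, f x * g x ∂μ) ^ 2 ≤ (∫⁻ x, f x ^ 2 ∂μ) * ∫⁻ x, g x ^ 2 ∂μ := by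
  have h := ENNReal.lintegral_mul_le_Lp_mul_Lq μ Real.HolderConjugate.two_two hf hg
  simp only [Pi.mul_apply, ENNReal.rpow_ofNat] at h
  calc _ ≤ _ := pow_le_pow_left' h 2
    _ = _ := by
      rw [mul_pow, ← ENNReal.rpow_natCast, ← ENNReal.rpow_natCast, ← ENNReal.rpow_mul,
        ← ENNReal.rpow_mul]
      simp

lemma enorm_integral_mul_sq_le {f g : α → ℂ} {μ : Measure α} (hf : AEStronglyMeasurable f μ)
    (hg : AEStronglyMeasurable g μ) :
    ‖∫ x, f x * g x ∂μ‖ₑ ^ 2 ≤ (∫⁻ x, ‖f x‖ₑ ^ 2 ∂μ) * ∫⁻ x, ‖g x‖ₑ ^ 2 ∂μ := by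
  refine le_trans ?_ (lintegral_mul_sq_le hf.enorm hg.enorm)
  gcongr
  refine (enorm_integral_le_lintegral_enorm _).trans_eq ?_
  simp [enorm_mul]

lemma ae_memLp_right {μ : Measure α} {ν : Measure β} [SFinite μ] [SFinite ν] {K : α × β → ℂ}
    (hK : MemLp K 2 (μ.prod ν)) : ∀ᵐ x ∂μ, MemLp (fun y => K (x, y)) 2 ν := by
  have h := hK.lintegral_sq_lt_top
  have hm : AEMeasurable (fun q => ‖K q‖ₑ ^ 2) (μ.prod ν) := hK.1.enorm.pow_const 2
  rw [lintegral_prod _ hm] at h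
  filter_upwards [ae_lt_top' hm.lintegral_prod_right' h.ne, hK.1.prodMk_left] with x h1 h2
  exact (memLp_two_iff h2).2 h1

/-- Cauchy-Schwarz on each fibre bounds the norm by `‖w‖ ‖K‖`. With `x` a random outcome, this gives
pairings of a process a finite second moment. -/
lemma memLp_integral_mul {μ : Measure α} {ν : Measure β} [SFinite μ] [SFinite ν] {K : α × β → ℂ}
    {w : β → ℂ} (hK : MemLp K 2 (μ.prod ν)) (hw : MemLp w 2 ν) :
    MemLp (fun x => ∫ y, w y * K (x, y) ∂ν) 2 μ := by
  have hm : AEMeasurable (fun q => ‖K q‖ₑ ^ 2) (μ.prod ν) := hK.1.enorm.pow_const 2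
  have hsm : AEStronglyMeasurable (fun x => ∫ y, w y * K (x, y) ∂ν) μ :=
    (hw.1.comp_snd.mul hK.1).integral_prod_right'
  rw [memLp_two_iff hsm]
  calc ∫⁻ x, ‖∫ y, w y * K (x, y) ∂ν‖ₑ ^ 2 ∂μ
      ≤ ∫⁻ x, (∫⁻ y, ‖w y‖ₑ ^ 2 ∂ν) * ∫⁻ y, ‖K (x, y)‖ₑ ^ 2 ∂ν ∂μ := by
        refine lintegral_mono_ae ?_
        filter_upwards [hK.1.prodMk_left] with x hx
        exact enorm_integral_mul_sq_le hw.1 hx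
    _ = (∫⁻ y, ‖w y‖ₑ ^ 2 ∂ν) * ∫⁻ q, ‖K q‖ₑ ^ 2 ∂(μ.prod ν) := by
        rw [lintegral_const_mul'' _ hm.lintegral_prod_right', lintegral_prod _ hm]
    _ < ⊤ := ENNReal.mul_lt_top hw.lintegral_sq_lt_top hK.lintegral_sq_lt_top

lemma memLp_mul_prod {μ : Measure α} {ν : Measure β} [SFinite μ] [SFinite ν] {f : α → ℂ}
    {g : β → ℂ} (hf : MemLp f 2 μ) (hg : MemLp g 2 ν) :
    MemLp (fun q : α × β => f q.1 * g q.2) 2 (μ.prod ν) := by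
  have hm : AEStronglyMeasurable (fun q : α × β => f q.1 * g q.2) (μ.prod ν) :=
    hf.1.comp_fst.mul hg.1.comp_snd
  rw [memLp_two_iff hm]
  simp only [enorm_mul, mul_pow]
  rw [lintegral_prod_mul (hf.1.enorm.pow_const 2) (hg.1.enorm.pow_const 2)]
  exact ENNReal.mul_lt_top hf.lintegral_sq_lt_top hg.lintegral_sq_lt_top

lemma _root_.MeasureTheory.MemLp.star_two {f : α → ℂ} {μ : Measure α} (hf : MemLp f 2 μ) :
    MemLp (fun x => star (f x)) 2 μ := by
  refine MemLp.of_le hf (continuous_star.comp_aestronglyMeasurable hf.1) ?_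
  simp

lemma _root_.MeasureTheory.MemLp.mul_norm_one {f u : α → ℂ} {μ : Measure α} (hf : MemLp f 2 μ)
    (hu : AEStronglyMeasurable u μ) (h1 : ∀ x, ‖u x‖ = 1) : MemLp (fun x => u x * f x) 2 μ :=
  MemLp.of_le hf (hu.mul hf.1) (by simp [h1])

end L2

/-! ### Orthonormal bases of `L²`, as families of functions -/

section ONB

variable {ι κ X Y Z : Type*} [MeasurableSpace X] [MeasurableSpace Y] [MeasurableSpace Z]

/-- The functions `v i` form an orthonormal basis of `L²(ν)`. -/
structure IsONB (ν : Measure Y) (v : ι → Y → ℂ) : Prop where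
  memLp : ∀ i, MemLp (v i) 2 ν
  orthonormal : ∀ i j, i ≠ j → ∫ y, star (v i y) * v j y ∂ν = 0
  normalized : ∀ i, ∫ y, star (v i y) * v i y ∂ν = 1
  complete : ∀ g : Y → ℂ, MemLp g 2 ν → (∀ i, ∫ y, star (v i y) * g y ∂ν = 0) → g =ᵐ[ν] 0

/-- The error of the partial sum over `F` of the expansion of `g` with respect to `v`. -/
def residual (ν : Measure Y) (v : ι → Y → ℂ) (g : Y → ℂ) (F : Finset ι) (y : Y) : ℂ :=
  g y - ∑ i ∈ F, (∫ y', star (v i y') * g y' ∂ν) * v i y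

lemma inner_toLp {ν : Measure Y} {f g : Y → ℂ} (hf : MemLp f 2 ν) (hg : MemLp g 2 ν) :
    inner ℂ hf.toLp hg.toLp = ∫ y, star (f y) * g y ∂ν := by
  rw [L2.inner_def]
  refine integral_congr_ae ?_
  filter_upwards [hf.coeFn_toLp, hg.coeFn_toLp] with y h1 h2
  rw [h1, h2, RCLike.inner_apply, mul_comm]
  rfl

namespace IsONB

variable {ν : Measure Y} {v : ι → Y → ℂ}

lemma orthonormal_toLp (hv : IsONB ν v) : Orthonormal ℂ fun i => (hv.memLp i).toLp := by
  classical
  rw [orthonormal_iff_ite]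
  intro i j
  rw [inner_toLp]
  split_ifs with h
  · subst h
    exact hv.normalized i
  · exact hv.orthonormal i j h

lemma span_orthogonal (hv : IsONB ν v) :
    (Submodule.span ℂ (Set.range fun i => (hv.memLp i).toLp))ᗮ = ⊥ := by
  rw [Submodule.eq_bot_iff]
  intro G hG
  have h0 : (G : Y → ℂ) =ᵐ[ν] 0 := by
    refine hv.complete _ (Lp.memLp G) fun i => ?_
    rw [← inner_toLp (hv.memLp i) (Lp.memLp G), Lp.toLp_coeFn]
    exact (Submodule.mem_orthogonal _ _).1 hG _ (Submodule.subset_span ⟨i, rfl⟩)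
  exact (Lp.eq_zero_iff_ae_eq_zero).2 h0

lemma eLpNorm_residual (hv : IsONB ν v) {g : Y → ℂ} (hg : MemLp g 2 ν) (F : Finset ι) :
    eLpNorm (residual ν v g F) 2 ν =
      ‖hg.toLp - ∑ i ∈ F, inner ℂ (hv.memLp i).toLp hg.toLp • (hv.memLp i).toLp‖ₑ := by
  have hm : ∀ i, MemLp (fun y => (∫ y', star (v i y') * g y' ∂ν) * v i y) 2 ν :=
    fun i => (hv.memLp i).const_mul _
  have hr : MemLp (residual ν v g F) 2 ν := hg.sub (memLp_finsetSum F fun i _ => hm i)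
  rw [← Lp.enorm_toLp (hf := hr)]
  congr 1
  refine Lp.ext ?_
  have hs : ∀ᵐ y ∂ν, ∀ i ∈ F, ((inner ℂ (hv.memLp i).toLp hg.toLp • (hv.memLp i).toLp :
      Lp ℂ 2 ν) : Y → ℂ) y = (∫ y', star (v i y') * g y' ∂ν) * v i y := by
    refine (ae_ball_iff F.countable_toSet).2 fun i _ => ?_
    filter_upwards [Lp.coeFn_smul (inner ℂ (hv.memLp i).toLp hg.toLp) (hv.memLp i).toLp,
      (hv.memLp i).coeFn_toLp] with y h1 h2
    rw [h1, Pi.smul_apply, h2, inner_toLp, smul_eq_mul]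
  filter_upwards [hr.coeFn_toLp, hg.coeFn_toLp, Lp.coeFn_sub hg.toLp
    (∑ i ∈ F, inner ℂ (hv.memLp i).toLp hg.toLp • (hv.memLp i).toLp), hs,
    Lp.coeFn_finsetSum F fun i => (inner ℂ (hv.memLp i).toLp hg.toLp • (hv.memLp i).toLp :
      Lp ℂ 2 ν)] with y h1 h2 h3 h4 h5
  rw [h1, h3, Pi.sub_apply, h2, h5, Finset.sum_apply, Finset.sum_congr rfl h4]
  rfl

lemma tendsto_residual (hv : IsONB ν v) {g : Y → ℂ} (hg : MemLp g 2 ν) :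
    Tendsto (fun F => eLpNorm (residual ν v g F) 2 ν) atTop (𝓝 0) := by
  have h := (HilbertBasis.mkOfOrthogonalEqBot hv.orthonormal_toLp
    hv.span_orthogonal).hasSum_repr hg.toLp
  simp only [HilbertBasis.repr_apply_apply, HilbertBasis.coe_mkOfOrthogonalEqBot] at h
  simp only [hv.eLpNorm_residual hg]
  have h2 := (tendsto_const_nhds (x := hg.toLp)).sub h
  rw [sub_self] at h2
  simpa using h2.enorm

/-- The error is orthogonal to the partial sum, so Pythagoras applies. This is the dominating bound
in `tendsto_residual_prod`. -/
lemma eLpNorm_residual_le (hv : IsONB ν v) {g : Y → ℂ} (hg : MemLp g 2 ν) (F : Finset ι) :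
    eLpNorm (residual ν v g F) 2 ν ≤ eLpNorm g 2 ν := by
  rw [hv.eLpNorm_residual hg, ← Lp.enorm_toLp (hf := hg)]
  set G := hg.toLp
  set S := ∑ i ∈ F, inner ℂ (hv.memLp i).toLp G • (hv.memLp i).toLp with hS
  have h1 : inner ℂ S (G - S) = 0 := by
    conv_lhs => rw [hS, sum_inner]
    refine Finset.sum_eq_zero fun i hi => ?_
    rw [inner_smul_left, inner_sub_right,
      hv.orthonormal_toLp.inner_right_sum (fun i => inner ℂ (hv.memLp i).toLp G) hi, sub_self,
      mul_zero]
  have h2 := norm_add_sq_eq_norm_sq_add_norm_sq_of_inner_eq_zero S (G - S) h1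
  rw [add_sub_cancel] at h2
  have h3 : ‖G - S‖ ≤ ‖G‖ := by nlinarith [norm_nonneg G, norm_nonneg S, norm_nonneg (G - S)]
  exact enorm_le_iff_norm_le.2 h3

lemma reindex (hv : IsONB ν v) (σ : κ ≃ ι) : IsONB ν fun i => v (σ i) where
  memLp i := hv.memLp _
  orthonormal i j hij := hv.orthonormal _ _ (σ.injective.ne hij)
  normalized i := hv.normalized _
  complete g hg h := hv.complete g hg fun i => by simpa using h (σ.symm i)

/-- Only completeness needs an argument. The pairing of `g (y, ·)` with a fixed `w k` is an `L²`
function of `y` orthogonal to every `v i`, so it vanishes almost everywhere; countability of `κ`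
yields one null set for all `k`, and completeness of `w` finishes on each remaining fibre. -/
lemma prod {ρ : Measure Z} [SFinite ν] [SFinite ρ] [Countable ι] [Countable κ] {w : κ → Z → ℂ}
    (hv : IsONB ν v) (hw : IsONB ρ w) :
    IsONB (ν.prod ρ) fun (i : ι × κ) (q : Y × Z) => v i.1 q.1 * w i.2 q.2 := by
  have key : ∀ i j : ι × κ, ∫ q : Y × Z, star (v i.1 q.1 * w i.2 q.2) * (v j.1 q.1 * w j.2 q.2)
      ∂(ν.prod ρ) = (∫ y, star (v i.1 y) * v j.1 y ∂ν) * ∫ z, star (w i.2 z) * w j.2 z ∂ρ := by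
    intro i j
    rw [← integral_prod_mul]
    congr 1
    ext q
    simp only [star_mul']
    ring
  refine ⟨fun i => memLp_mul_prod (hv.memLp _) (hw.memLp _), fun i j hij => ?_, fun i => ?_,
    fun g hg h => ?_⟩
  · rw [key]
    by_cases h1 : i.1 = j.1
    · rw [hw.orthonormal _ _ fun h2 => hij (Prod.ext h1 h2), mul_zero]
    · rw [hv.orthonormal _ _ h1, zero_mul]
  · rw [key, hv.normalized, hw.normalized, one_mul]
  · have hz : ∀ k, ∀ᵐ y ∂ν, ∫ z, star (w k z) * g (y, z) ∂ρ = 0 := by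
      intro k
      refine hv.complete _ (memLp_integral_mul hg (hw.memLp k).star_two) fun i => ?_
      rw [← h (i, k), integral_prod]
      · refine integral_congr_ae (ae_of_all _ fun y => ?_)
        simp only [star_mul', ← integral_const_mul, mul_assoc]
      · exact (memLp_mul_prod (hv.memLp i) (hw.memLp k)).star_two.integrable_mul hg
    have hz' : ∀ᵐ y ∂ν, ∀ᵐ z ∂ρ, g (y, z) = 0 := by
      filter_upwards [ae_all_iff.2 hz, ae_memLp_right hg] with y h1 h2
      exact hw.complete _ h2 h1
    have hn : ∫⁻ q, ‖g q‖ₑ ^ 2 ∂(ν.prod ρ) = 0 := by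
      rw [lintegral_prod _ (hg.1.enorm.pow_const 2)]
      refine (lintegral_congr_ae ?_).trans lintegral_zero
      filter_upwards [hz'] with y hy
      refine (lintegral_congr_ae ?_).trans lintegral_zero
      filter_upwards [hy] with z hz
      simp [hz]
    rw [lintegral_eq_zero_iff' (hg.1.enorm.pow_const 2)] at hn
    filter_upwards [hn] with q hq
    simpa using hq

lemma aestronglyMeasurable_residual {μ : Measure X} [SFinite μ] [SFinite ν] (hv : IsONB ν v)
    {K : X × Y → ℂ} (hK : AEStronglyMeasurable K (μ.prod ν)) (F : Finset ι) :
    AEStronglyMeasurable (fun q : X × Y => residual ν v (fun y => K (q.1, y)) F q.2)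
      (μ.prod ν) := by
  refine hK.sub (Finset.aestronglyMeasurable_fun_sum F fun i _ => ?_)
  refine AEStronglyMeasurable.mul ?_ (hv.memLp i).1.comp_snd
  have : AEStronglyMeasurable (fun x => ∫ y, star (v i y) * K (x, y) ∂ν) μ :=
    ((hv.memLp i).star_two.1.comp_snd.mul hK).integral_prod_right'
  exact this.comp_fst

/-- The expansion converges on almost every fibre, and the squared fibre errors are bounded by the
squared fibre norms of `K`, which are integrable; dominated convergence applies. -/
lemma tendsto_residual_prod {μ : Measure X} [SFinite μ] [SFinite ν] [Countable ι]
    (hv : IsONB ν v) {K : X × Y → ℂ} (hK : MemLp K 2 (μ.prod ν)) :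
    Tendsto (fun F => eLpNorm (fun q : X × Y => residual ν v (fun y => K (q.1, y)) F q.2) 2
      (μ.prod ν)) atTop (𝓝 0) := by
  have hm : ∀ F, AEMeasurable (fun q : X × Y => ‖residual ν v (fun y => K (q.1, y)) F q.2‖ₑ ^ 2)
      (μ.prod ν) := fun F => (hv.aestronglyMeasurable_residual hK.1 F).enorm.pow_const 2
  have hKm : AEMeasurable (fun q => ‖K q‖ₑ ^ 2) (μ.prod ν) := hK.1.enorm.pow_const 2
  have hsq : Tendsto (fun F => eLpNorm (fun q : X × Y => residual ν v (fun y => K (q.1, y)) F q.2) 2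
      (μ.prod ν) ^ 2) atTop (𝓝 0) := by
    simp only [eLpNorm_two_sq]
    simp only [lintegral_prod _ (hm _)]
    rw [← lintegral_zero (μ := μ)]
    -- Dominated convergence is used along sequences; this suffices because the finite subsets of a
    -- countable `ι` form a countably generated filter.
    refine tendsto_of_seq_tendsto fun u hu => ?_
    refine tendsto_lintegral_of_dominated_convergence'
      (fun x => ∫⁻ y, ‖K (x, y)‖ₑ ^ 2 ∂ν) (fun n => (hm (u n)).lintegral_prod_right')
      (fun n => ?_) ?_ ?_
    · filter_upwards [ae_memLp_right hK] with x hx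
      have := pow_le_pow_left' (hv.eLpNorm_residual_le hx (u n)) 2
      rwa [eLpNorm_two_sq, eLpNorm_two_sq] at this
    · rw [← lintegral_prod _ hKm]
      exact hK.lintegral_sq_lt_top.ne
    · filter_upwards [ae_memLp_right hK] with x hx
      have := ENNReal.Tendsto.pow (n := 2) ((hv.tendsto_residual hx).comp hu)
      simpa [eLpNorm_two_sq] using this
  have h2 := hsq.ennrpow_const (1 / 2)
  have hhalf : ∀ x : ENNReal, (x ^ 2) ^ (1 / 2 : ℝ) = x := fun x => by
    rw [← ENNReal.rpow_natCast, ← ENNReal.rpow_mul]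
    simp
  simp only [hhalf] at h2
  simpa using h2

end IsONB

end ONB

/-! ### The exponential basis -/

lemma integral_e_mul_div {b : ℝ} (hb : 0 < b) {k : ℤ} (hk : k ≠ 0) :
    ∫ y in Set.Ico 0 b, e (k * y / b) = 0 := by
  rw [integral_Ico_eq_integral_Ioc, ← intervalIntegral.integral_of_le hb.le]
  have hb' : (b : ℂ) ≠ 0 := by exact_mod_cast hb.ne'
  have hk' : (k : ℂ) ≠ 0 := by exact_mod_cast hk
  have hc : 2 * (Real.pi : ℂ) * Complex.I * k / b ≠ 0 := by
    have : (Real.pi : ℂ) ≠ 0 := by exact_mod_cast Real.pi_ne_zero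
    simp [hb', hk', this]
  have h := integral_exp_mul_complex (a := 0) (b := b) hc
  have h1 : Complex.exp (2 * (Real.pi : ℂ) * Complex.I * k / b * b) = 1 := by
    rw [div_mul_cancel₀ _ hb', Complex.exp_eq_one_iff]
    exact ⟨k, by ring⟩
  rw [h1] at h
  simp only [Complex.ofReal_zero, mul_zero, Complex.exp_zero, sub_self, zero_div] at h
  rw [← h]
  refine intervalIntegral.integral_congr fun y _ => ?_
  simp only [e]
  congr 1
  push_cast
  ring

/-- The normalized exponential `e (m y / b) / √b`. -/
def expFun (b : ℝ) (m : ℤ) (y : ℝ) : ℂ := ((√b)⁻¹ : ℝ) * e (m * y / b)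

lemma measurable_expFun (b : ℝ) (m : ℤ) : Measurable (expFun b m) := by
  unfold expFun
  exact (measurable_e.comp (by fun_prop)).const_mul _

lemma star_expFun_mul {b : ℝ} (hb : 0 < b) (m : ℤ) (y y' : ℝ) :
    star (expFun b m y') * expFun b m y = (b : ℂ)⁻¹ * (e (-(m * y' / b)) * e (m * y / b)) := by
  have h : (((√b)⁻¹ : ℝ) : ℂ) * (((√b)⁻¹ : ℝ) : ℂ) = (b : ℂ)⁻¹ := by
    rw [← Complex.ofReal_mul, ← mul_inv, Real.mul_self_sqrt hb.le, Complex.ofReal_inv]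
  rw [expFun, expFun, star_mul', star_e, Complex.star_def, Complex.conj_ofReal, ← h]
  ring

lemma isONB_expFun {b : ℝ} (hb : 0 < b) :
    IsONB (volume.restrict (Set.Ico 0 b)) (expFun b) := by
  have hcross : ∀ i j y, star (expFun b i y) * expFun b j y
      = (b : ℂ)⁻¹ * e (((j - i : ℤ) : ℝ) * y / b) := by
    intro i j y
    have h := star_expFun_mul hb i y y
    rw [e_neg_mul_self, mul_one] at h
    have h2 : expFun b j y = expFun b i y * e (((j - i : ℤ) : ℝ) * y / b) := by
      rw [expFun, expFun, mul_assoc, ← e_add]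
      congr 2
      push_cast
      ring
    rw [h2, ← mul_assoc, h]
  refine ⟨fun m => ?_, fun i j hij => ?_, fun i => ?_, fun g hg h => ?_⟩
  · refine MemLp.of_bound (measurable_expFun b m).aestronglyMeasurable ‖(((√b)⁻¹ : ℝ) : ℂ)‖
      (ae_of_all _ fun y => ?_)
    rw [expFun, norm_mul, norm_e, mul_one]
  · simp only [hcross]
    rw [integral_const_mul, integral_e_mul_div hb (sub_ne_zero.2 hij.symm), mul_zero]
  · simp only [hcross, sub_self, Int.cast_zero, zero_mul, zero_div, e_zero, mul_one]
    have hb' : (b : ℂ) ≠ 0 := by exact_mod_cast hb.ne'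
    simp [measureReal_def, hb.le, hb']
  · have hg' : MemLp g 2 (volume.restrict (Set.Ioc 0 b)) := by
      rwa [← restrict_Ico_eq_restrict_Ioc]
    have hc : ∀ i, fourierCoeffOn hb g i = 0 := by
      intro i
      have hi := h i
      rw [restrict_Ico_eq_restrict_Ioc, ← intervalIntegral.integral_of_le hb.le] at hi
      have hr : (((√b)⁻¹ : ℝ) : ℂ) ≠ 0 := by
        exact_mod_cast inv_ne_zero (Real.sqrt_pos.2 hb).ne'
      rw [fourierCoeffOn_eq_integral, smul_eq_zero]
      right
      have he : ∀ y, star (expFun b i y) * g y = (((√b)⁻¹ : ℝ) : ℂ) *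
          (fourier (-i) (y : AddCircle (b - 0)) • g y) := by
        intro y
        rw [fourier_coe_apply, expFun, star_mul', star_e, Complex.star_def, Complex.conj_ofReal,
          mul_assoc, smul_eq_mul, e]
        congr 3
        push_cast
        ring_nf
      simp only [he] at hi
      rw [intervalIntegral.integral_const_mul] at hi
      exact (mul_eq_zero.1 hi).resolve_left hr
    -- Parseval: vanishing Fourier coefficients force `∫ ‖g‖² = 0`.
    have hp := hasSum_sq_fourierCoeffOn hb hg'
    simp only [hc, norm_zero, ne_eq, OfNat.ofNat_ne_zero, not_false_eq_true, zero_pow] at hp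
    have h0 := hp.unique hasSum_zero
    rw [smul_eq_zero, intervalIntegral.integral_of_le hb.le] at h0
    have h1 := h0.resolve_left (by simp [hb.ne'])
    rw [integral_eq_zero_iff_of_nonneg (fun _ => by positivity)
      hg'.integrable_norm_pow'] at h1
    rw [restrict_Ico_eq_restrict_Ioc]
    filter_upwards [h1] with y hy
    simpa using hy

/-- The orthonormal basis of `L²([0, b)²)` with members proportional to
`e ((m y - m' y') / b)`. -/
def expFun₂ (b : ℝ) (m : ℤ × ℤ) (y : ℝ × ℝ) : ℂ := expFun b m.1 y.1 * expFun b (-m.2) y.2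

lemma isONB_expFun₂ {b : ℝ} (hb : 0 < b) :
    IsONB ((volume.restrict (Set.Ico 0 b)).prod (volume.restrict (Set.Ico 0 b))) (expFun₂ b) :=
  (isONB_expFun hb).prod ((isONB_expFun hb).reindex (Equiv.neg ℤ))

lemma star_expFun₂_mul {b : ℝ} (hb : 0 < b) (m : ℤ × ℤ) (y y' : ℝ × ℝ) :
    star (expFun₂ b m y') * expFun₂ b m y = ((b : ℂ) ^ 2)⁻¹ *
      (e (-((m.1 * y'.1 - m.2 * y'.2) / b)) * e ((m.1 * y.1 - m.2 * y.2) / b)) := by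
  have h1 := star_expFun_mul hb m.1 y.1 y'.1
  have h2 := star_expFun_mul hb (-m.2) y.2 y'.2
  rw [expFun₂, expFun₂, star_mul', mul_mul_mul_comm, h1, h2]
  rw [show -((m.1 * y'.1 - m.2 * y'.2) / b)
    = -(m.1 * y'.1 / b) + -(((-m.2 : ℤ) : ℝ) * y'.2 / b) by push_cast; ring,
    show (m.1 * y.1 - m.2 * y.2) / b
    = m.1 * y.1 / b + ((-m.2 : ℤ) : ℝ) * y.2 / b by push_cast; ring, e_add, e_add]
  ring

/-- The normalizations `1 / √b`, two for each of the two variables, are the source of the factor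
`b⁻²` in the reconstruction formula. -/
lemma residual_expFun₂ {b : ℝ} (hb : 0 < b) (ν : Measure (ℝ × ℝ)) (g : ℝ × ℝ → ℂ)
    (F : Finset (ℤ × ℤ)) (y : ℝ × ℝ) :
    residual ν (expFun₂ b) g F y = g y - ((b : ℂ) ^ 2)⁻¹ * ∑ m ∈ F,
      e ((m.1 * y.1 - m.2 * y.2) / b) *
        ∫ y', g y' * e (-((m.1 * y'.1 - m.2 * y'.2) / b)) ∂ν := by
  rw [residual, Finset.mul_sum]
  congr 1
  refine Finset.sum_congr rfl fun m _ => ?_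
  rw [← integral_mul_const, ← integral_const_mul, ← integral_const_mul]
  congr 1
  ext y'
  linear_combination g y' * star_expFun₂_mul hb m y y'

/-! ### Second moments of processes -/

section Processes

variable {Ω Z Z' : Type*} [MeasurableSpace Ω] [MeasurableSpace Z] [MeasurableSpace Z']
  {P : Measure Ω} {μ : Measure Z} {μ' : Measure Z'} [SFinite P] [SFinite μ] [SFinite μ']

lemma measurePreserving_assoc_left :
    MeasurePreserving (fun q : Ω × (Z × Z') => ((q.1, q.2.1), q.2.2)) (P.prod (μ.prod μ'))
      ((P.prod μ).prod μ') :=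
  MeasurePreserving.symm MeasurableEquiv.prodAssoc
    ⟨MeasurableEquiv.prodAssoc.measurable, Measure.prodAssoc_prod⟩

lemma measurePreserving_assoc_right :
    MeasurePreserving (fun q : Ω × (Z × Z') => ((q.1, q.2.2), q.2.1)) (P.prod (μ.prod μ'))
      ((P.prod μ').prod μ) :=
  (measurePreserving_assoc_left (P := P) (μ := μ') (μ' := μ)).comp
    ((MeasurePreserving.id P).prod Measure.measurePreserving_swap)

/-- Regrouping the four factors as `X · conj w'` times `conj Y · w` exhibits a product of two `L²`
functions on the triple product. -/
lemma integrable_mul_cross {X : Ω × Z → ℂ} {Y : Ω × Z' → ℂ} {w : Z → ℂ} {w' : Z' → ℂ}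
    (hX : MemLp X 2 (P.prod μ)) (hY : MemLp Y 2 (P.prod μ')) (hw : MemLp w 2 μ)
    (hw' : MemLp w' 2 μ') :
    Integrable (fun q : Ω × (Z × Z') =>
      (w q.2.1 * X (q.1, q.2.1)) * star (w' q.2.2 * Y (q.1, q.2.2))) (P.prod (μ.prod μ')) := by
  have h1 := (memLp_mul_prod hX hw'.star_two).comp_measurePreserving
    (measurePreserving_assoc_left (P := P) (μ := μ) (μ' := μ'))
  have h2 := (memLp_mul_prod hY.star_two hw).comp_measurePreserving
    (measurePreserving_assoc_right (P := P) (μ := μ) (μ' := μ'))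
  refine (h1.integrable_mul h2).congr (ae_of_all _ fun q => ?_)
  simp only [Pi.mul_apply, Function.comp_apply, star_mul']
  ring

/-- Fubini: the covariance of two linear functionals of processes is the cross-correlation
integrated against their weights. -/
lemma integral_cross {X : Ω × Z → ℂ} {Y : Ω × Z' → ℂ} {w : Z → ℂ} {w' : Z' → ℂ}
    (hX : MemLp X 2 (P.prod μ)) (hY : MemLp Y 2 (P.prod μ')) (hw : MemLp w 2 μ)
    (hw' : MemLp w' 2 μ') :
    ∫ ω, (∫ z, w z * X (ω, z) ∂μ) * star (∫ z', w' z' * Y (ω, z') ∂μ') ∂P =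
      ∫ q : Z × Z', w q.1 * star (w' q.2) * ∫ ω, X (ω, q.1) * star (Y (ω, q.2)) ∂P
        ∂(μ.prod μ') := by
  have hint := integrable_mul_cross hX hY hw hw'
  calc _ = ∫ ω, ∫ q : Z × Z', (w q.1 * X (ω, q.1)) * star (w' q.2 * Y (ω, q.2)) ∂(μ.prod μ') ∂P := by
        congr 1
        ext ω
        have := integral_prod_mul (μ := μ) (ν := μ') (fun z => w z * X (ω, z))
          (fun z' => star (w' z' * Y (ω, z')))
        rw [this]
        congr 1
        exact integral_conj.symm
    _ = ∫ q : Z × Z', ∫ ω, (w q.1 * X (ω, q.1)) * star (w' q.2 * Y (ω, q.2)) ∂P ∂(μ.prod μ') :=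
        integral_integral_swap hint
    _ = _ := by
        congr 1
        ext q
        rw [← integral_const_mul]
        congr 1
        ext ω
        rw [star_mul']
        ring

/-- Cauchy-Schwarz in `ω` bounds the squared correlation by a product of mean energies, one in each
variable. -/
lemma memLp_cross {X : Ω × Z → ℂ} {Y : Ω × Z' → ℂ} (hX : MemLp X 2 (P.prod μ))
    (hY : MemLp Y 2 (P.prod μ')) :
    MemLp (fun q : Z × Z' => ∫ ω, X (ω, q.1) * star (Y (ω, q.2)) ∂P) 2 (μ.prod μ') := by
  have hX1 : AEStronglyMeasurable (fun q : Ω × (Z × Z') => X (q.1, q.2.1))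
      (P.prod (μ.prod μ')) :=
    hX.1.comp_fst.comp_measurePreserving measurePreserving_assoc_left
  have hY1 : AEStronglyMeasurable (fun q : Ω × (Z × Z') => star (Y (q.1, q.2.2)))
      (P.prod (μ.prod μ')) :=
    hY.star_two.1.comp_fst.comp_measurePreserving measurePreserving_assoc_right
  have hm : AEStronglyMeasurable (fun q : Z × Z' => ∫ ω, X (ω, q.1) * star (Y (ω, q.2)) ∂P)
      (μ.prod μ') := (hX1.mul hY1).prod_swap.integral_prod_right'
  rw [memLp_two_iff hm]
  have hXm : AEMeasurable (fun q => ‖X q‖ₑ ^ 2) (P.prod μ) := hX.1.enorm.pow_const 2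
  have hYm : AEMeasurable (fun q => ‖Y q‖ₑ ^ 2) (P.prod μ') := hY.1.enorm.pow_const 2
  calc _ ≤ ∫⁻ q : Z × Z', (∫⁻ ω, ‖X (ω, q.1)‖ₑ ^ 2 ∂P) * ∫⁻ ω, ‖Y (ω, q.2)‖ₑ ^ 2 ∂P
        ∂(μ.prod μ') := by
        refine lintegral_mono_ae ?_
        filter_upwards [Measure.quasiMeasurePreserving_fst.ae hX.1.prodMk_right,
          Measure.quasiMeasurePreserving_snd.ae hY.star_two.1.prodMk_right] with q h1 h2
        refine (enorm_integral_mul_sq_le h1 h2).trans_eq ?_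
        simp
    _ = (∫⁻ q, ‖X q‖ₑ ^ 2 ∂(P.prod μ)) * ∫⁻ q, ‖Y q‖ₑ ^ 2 ∂(P.prod μ') := by
        rw [lintegral_prod_mul (f := fun z => ∫⁻ ω, ‖X (ω, z)‖ₑ ^ 2 ∂P)
          (g := fun z => ∫⁻ ω, ‖Y (ω, z)‖ₑ ^ 2 ∂P) hXm.lintegral_prod_left'
          hYm.lintegral_prod_left', lintegral_prod_symm _ hXm, lintegral_prod_symm _ hYm]
    _ < ⊤ := ENNReal.mul_lt_top hX.lintegral_sq_lt_top hY.lintegral_sq_lt_top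

lemma ae_ae_swap_eq {X Y : Ω × Z → ℂ} (h : X =ᵐ[P.prod μ] Y) :
    ∀ᵐ z ∂μ, ∀ᵐ ω ∂P, X (ω, z) = Y (ω, z) :=
  Measure.ae_ae_of_ae_prod (p := fun q : Z × Ω => X (q.2, q.1) = Y (q.2, q.1))
    ((Measure.measurePreserving_swap (μ := μ) (ν := P)).quasiMeasurePreserving.ae_eq_comp h)

lemma autocorr_congr {Ω T : Type*} [MeasurableSpace Ω] {P : Measure Ω} {X Y : Ω → T → ℂ}
    {z z' : T} (h : ∀ᵐ ω ∂P, X ω z = Y ω z)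
    (h' : ∀ᵐ ω ∂P, X ω z' = Y ω z') : autocorr P X (z, z') = autocorr P Y (z, z') := by
  refine integral_congr_ae ?_
  filter_upwards [h, h'] with ω h1 h2
  simp only [h1, h2]

lemma autocorr_ae_eq {X Y : Ω → Z → ℂ}
    (h : (fun q : Ω × Z => X q.1 q.2) =ᵐ[P.prod μ] fun q => Y q.1 q.2) :
    autocorr P X =ᵐ[μ.prod μ] autocorr P Y := by
  filter_upwards [Measure.quasiMeasurePreserving_fst.ae (ae_ae_swap_eq h),
    Measure.quasiMeasurePreserving_snd.ae (ae_ae_swap_eq h)] with q h1 h2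
  exact autocorr_congr h1 h2

/-- A process of finite mean energy vanishes when its autocorrelation does. -/
lemma ae_eq_zero_of_autocorr [MeasurableSpace.CountablyGenerated Z] {X : Ω × Z → ℂ}
    (hX : MemLp X 2 (P.prod μ))
    (h : ∀ᵐ q ∂(μ.prod μ), ∫ ω, X (ω, q.1) * star (X (ω, q.2)) ∂P = 0) :
    ∀ᵐ ω ∂P, ∀ᵐ z ∂μ, X (ω, z) = 0 := by
  -- For fixed `w` the second moment of the pairing is the autocorrelation integrated against `conj
  -- w ⊗ w`, hence zero.
  have h0 : ∀ w : Lp ℂ 2 μ, ∀ᵐ ω ∂P, ∫ z, star (w z) * X (ω, z) ∂μ = 0 := by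
    intro w
    have hw := (Lp.memLp w).star_two
    have hL := memLp_integral_mul hX hw
    have h1 := integral_cross hX hX hw hw
    have h2 : ∫ q : Z × Z, star (w q.1) * star (star (w q.2)) *
        ∫ ω, X (ω, q.1) * star (X (ω, q.2)) ∂P ∂(μ.prod μ) = 0 := by
      refine integral_eq_zero_of_ae ?_
      filter_upwards [h] with q hq
      rw [hq, mul_zero, Pi.zero_apply]
    rw [h2] at h1
    have h3 : ∫ ω, ‖∫ z, star (w z) * X (ω, z) ∂μ‖ ^ 2 ∂P = 0 := by
      rw [← Complex.ofReal_eq_zero, ← h1, ← integral_complex_ofReal]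
      congr 1
      ext ω
      rw [Complex.star_def, Complex.mul_conj']
      push_cast
      rfl
    rw [integral_eq_zero_iff_of_nonneg (fun _ => by positivity) (hL.integrable_norm_pow two_ne_zero)] at h3
    filter_upwards [h3] with ω hω
    simpa using hω
  have : Fact ((2 : ENNReal) ≠ ⊤) := ⟨by norm_num⟩
  -- The exceptional null set depends on `w`; a dense sequence in the separable space `L²` gives a
  -- common one, and continuity of the inner product covers the remaining `w`.
  have hall := ae_all_iff.2 fun n => h0 (TopologicalSpace.denseSeq (Lp ℂ 2 μ) n)
  filter_upwards [hall, ae_memLp_right hX] with ω h1 h2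
  have h3 : ∀ w : Lp ℂ 2 μ, inner ℂ w h2.toLp = 0 := by
    intro w
    refine (TopologicalSpace.denseRange_denseSeq (Lp ℂ 2 μ)).induction_on
      (p := fun w => inner ℂ w h2.toLp = 0) w ?_ fun n => ?_
    · exact isClosed_eq (by fun_prop) continuous_const
    · have := inner_toLp (Lp.memLp (TopologicalSpace.denseSeq (Lp ℂ 2 μ) n)) h2
      rw [Lp.toLp_coeFn] at this
      rw [this, h1 n]
  have h4 := inner_self_eq_zero.1 (h3 h2.toLp)
  have h5 := (Lp.eq_zero_iff_ae_eq_zero).1 h4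
  filter_upwards [h5, h2.coeFn_toLp] with z h6 h7
  rw [← h7, h6, Pi.zero_apply]

end Processes

/-! ### Cells -/

/-- Lebesgue measure on `[0, a)`. -/
abbrev icoMeasure (a : ℝ) : Measure ℝ := volume.restrict (Set.Ico 0 a)

/-- The Fourier expansion runs over both frequencies with both times fixed, so the coordinates are
regrouped into times and frequencies. -/
lemma measurePreserving_shuffle :
    MeasurePreserving (fun x : (ℝ × ℝ) × (ℝ × ℝ) => ((x.1.1, x.2.1), (x.1.2, x.2.2)))
      volume volume := by
  have h1 : MeasurePreserving (fun x : (ℝ × ℝ) × (ℝ × ℝ) => (x.1.1, (x.1.2, x.2)))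
      volume volume := measurePreserving_prodAssoc volume volume volume
  have h2 : MeasurePreserving (fun x : ℝ × (ℝ × (ℝ × ℝ)) => (x.1, ((x.2.1, x.2.2.2), x.2.2.1)))
      volume volume :=
    (MeasurePreserving.id (volume : Measure ℝ)).prod
      (measurePreserving_assoc_right (P := volume) (μ := volume) (μ' := volume))
  have h3 : MeasurePreserving (fun x : ℝ × ((ℝ × ℝ) × ℝ) => (x.1, (x.2.2, x.2.1)))
      volume volume :=
    (MeasurePreserving.id (volume : Measure ℝ)).prod Measure.measurePreserving_swap
  have h4 : MeasurePreserving (fun x : ℝ × (ℝ × (ℝ × ℝ)) => ((x.1, x.2.1), x.2.2))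
      volume volume :=
    measurePreserving_assoc_left (P := volume) (μ := volume) (μ' := volume)
  exact h4.comp (h3.comp (h2.comp h1))

/-- The offset of the cell with index `j`. -/
def offset (a b : ℝ) (j : Idx) : TF × TF :=
  ((a * j.1.1, b * j.1.2), (a * j.2.1, b * j.2.2))

/-- The point of the cell `j` with time coordinates `x.1` and frequency coordinates `x.2` relative
to the corner. -/
def place (a b : ℝ) (j : Idx) (x : (ℝ × ℝ) × (ℝ × ℝ)) : TF × TF :=
  ((x.1.1 + a * j.1.1, x.2.1 + b * j.1.2), (x.1.2 + a * j.2.1, x.2.2 + b * j.2.2))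

/-- The inverse of `place`. -/
def unplace (a b : ℝ) (j : Idx) (q : TF × TF) : (ℝ × ℝ) × (ℝ × ℝ) :=
  ((q.1.1 - a * j.1.1, q.2.1 - a * j.2.1), (q.1.2 - b * j.1.2, q.2.2 - b * j.2.2))

lemma place_unplace (a b : ℝ) (j : Idx) (q : TF × TF) : place a b j (unplace a b j q) = q := by
  simp [place, unplace]

lemma measurePreserving_translate (z : TF × TF) :
    MeasurePreserving (fun q : TF × TF => q + z) volume volume :=
  ((measurePreserving_add_right volume z.1.1).prod (measurePreserving_add_right volume z.1.2)).prod
    ((measurePreserving_add_right volume z.2.1).prod (measurePreserving_add_right volume z.2.2))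

lemma measurePreserving_place (a b : ℝ) (j : Idx) :
    MeasurePreserving (place a b j) volume volume :=
  (measurePreserving_translate (offset a b j)).comp measurePreserving_shuffle

lemma measurePreserving_unplace (a b : ℝ) (j : Idx) :
    MeasurePreserving (unplace a b j) volume volume := by
  have h := measurePreserving_shuffle.comp (measurePreserving_translate (-offset a b j))
  refine (congrArg (MeasurePreserving · volume volume) ?_).mp h
  ext q <;> simp [unplace, offset, sub_eq_add_neg]

/-- The box `[0, a)² × [0, b)²`. -/
def box (a b : ℝ) : Set ((ℝ × ℝ) × (ℝ × ℝ)) :=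
  (Set.Ico 0 a ×ˢ Set.Ico 0 a) ×ˢ (Set.Ico 0 b ×ˢ Set.Ico 0 b)

lemma measurableSet_box (a b : ℝ) : MeasurableSet (box a b) :=
  (measurableSet_Ico.prod measurableSet_Ico).prod (measurableSet_Ico.prod measurableSet_Ico)

lemma volume_restrict_box (a b : ℝ) : volume.restrict (box a b) =
    ((icoMeasure a).prod (icoMeasure a)).prod ((icoMeasure b).prod (icoMeasure b)) := by
  rw [Measure.prod_restrict, Measure.prod_restrict, Measure.prod_restrict]
  rfl

lemma unplace_mem_box {a b : ℝ} {j : Idx} {q : TF × TF} :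
    unplace a b j q ∈ box a b ↔ q ∈ cell a b j := by
  simp only [unplace, box, cell, rect, Set.mem_prod, Set.mem_ofPred_eq]
  tauto

lemma floor_div_eq {a t : ℝ} (ha : 0 < a) {k : ℤ} (h : t - a * k ∈ Set.Ico 0 a) :
    ⌊t / a⌋ = k := by
  rw [Int.floor_eq_iff, le_div_iff₀ ha, div_lt_iff₀ ha]
  constructor <;> nlinarith [h.1, h.2]

lemma cell_injective {a b : ℝ} (ha : 0 < a) (hb : 0 < b) {j j' : Idx} {q : TF × TF}
    (h : q ∈ cell a b j) (h' : q ∈ cell a b j') : j = j' := by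
  obtain ⟨⟨h1, h2⟩, h3, h4⟩ := h
  obtain ⟨⟨h1', h2'⟩, h3', h4'⟩ := h'
  refine Prod.ext (Prod.ext ?_ ?_) (Prod.ext ?_ ?_)
  · exact (floor_div_eq ha h1).symm.trans (floor_div_eq ha h1')
  · exact (floor_div_eq hb h2).symm.trans (floor_div_eq hb h2')
  · exact (floor_div_eq ha h3).symm.trans (floor_div_eq ha h3')
  · exact (floor_div_eq hb h4).symm.trans (floor_div_eq hb h4')

/-! ### The deterministic reconstruction -/

section Reconstruction

variable {a b : ℝ} {L : ℕ} [NeZero L]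

/-- Since `p.val` is an integer, replacing `n` by its residue modulo `L` changes the phase by an
integer. -/
lemma gabor_modL (c : ZMod L → ℂ) (p : ZMod L) (kn : ℤ × ℤ) :
    gabor c p (modL L kn) = e (kn.2 * p.val / L) * c (p - (kn.1 : ZMod L)) := by
  simp only [gabor, modL, Matrix.of_apply, finModul, finTrans]
  congr 1
  have h : ((((kn.2 : ZMod L).val : ℕ) : ℤ)) = kn.2 % (L : ℤ) := ZMod.val_intCast kn.2
  have h2 : kn.2 = (((kn.2 : ZMod L).val : ℕ) : ℤ) + L * (kn.2 / L) := by
    rw [h, Int.emod_add_mul_ediv]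
  have hL : (L : ℝ) ≠ 0 := by exact_mod_cast NeZero.ne L
  have h3 : (kn.2 : ℝ) * p.val / L
      = ((kn.2 : ZMod L).val : ℝ) * p.val / L + ((kn.2 / (L : ℤ) * p.val : ℤ) : ℝ) := by
    have h4 : (kn.2 : ℝ) = ((kn.2 : ZMod L).val : ℝ) + L * ((kn.2 / (L : ℤ) : ℤ) : ℝ) := by
      exact_mod_cast h2
    nth_rewrite 1 [h4]
    push_cast
    field_simp
  rw [h3, e_add_int]

lemma sum_leftInverse {Λ : Finset Idx} {c : ZMod L → ℂ} {A : Matrix Λ (ZMod L × ZMod L) ℂ}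
    (hA : A * gaborTensor c Λ = 1) (j j' : Λ) :
    ∑ p : ZMod L, ∑ p' : ZMod L, A j (p', p) * (gabor c p (modL L j'.1.1) *
      star (gabor c p' (modL L j'.1.2))) = if j = j' then 1 else 0 := by
  have h := congrFun (congrFun hA j) j'
  rw [Matrix.one_apply, Matrix.mul_apply, Fintype.sum_prod_type_right] at h
  rw [← h]
  refine Finset.sum_congr rfl fun p _ => Finset.sum_congr rfl fun p' _ => ?_
  simp only [gaborTensor, Matrix.submatrix_apply, Matrix.kroneckerMap_apply, Matrix.map_apply, id]
  ring

/-- From `a * b * L = 1` come `a b n p = n p / L`, `a m L = m / b` and `a b n m L = n m`. The first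
gives the Gabor modulation, the second the Fourier characters in `y` and `μ`, the third the final
integer, which `e` does not see. -/
lemma phase_eq (hb : 0 < b) (hab : a * b = 1 / (L : ℝ)) (s μ y p : ℝ) (n₀ n m : ℤ) :
    a * b * (n₀ * p) - (μ + b * n₀) * (s + a * (p - m * L)) + (y + b * n) * (s + a * (p - m * L)) =
      n * p / L + b * (n - n₀) * s - μ * (s + a * p) + m * μ / b + y * (s + a * p) - m * y / b
        + ((m * (n₀ - n) : ℤ) : ℝ) := by
  have hL : (L : ℝ) ≠ 0 := by exact_mod_cast NeZero.ne L
  have ha : a = 1 / (b * L) := by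
    field_simp
    field_simp at hab
    linarith
  subst ha
  push_cast
  field_simp
  ring

/-- The autocorrelation of the spreading function on the cell `j`, modulated. -/
def modCell (a b : ℝ) (R : TF × TF → ℂ) (j : Idx) (p p' : ZMod L) (x : (ℝ × ℝ) × (ℝ × ℝ)) : ℂ :=
  e (x.2.1 * (x.1.1 + a * p.val) - x.2.2 * (x.1.2 + a * p'.val)) * R (place a b j x)

omit [NeZero L] in
lemma memLp_modCell {R : TF × TF → ℂ} (hR : MemLp R 2 volume) (j : Idx) (p p' : ZMod L) :
    MemLp (modCell a b R j p p') 2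
      (((icoMeasure a).prod (icoMeasure a)).prod ((icoMeasure b).prod (icoMeasure b))) := by
  rw [← volume_restrict_box]
  have h : MemLp (fun x => R (place a b j x)) 2 volume :=
    hR.comp_measurePreserving (measurePreserving_place a b j)
  have hm : Measurable fun x : (ℝ × ℝ) × (ℝ × ℝ) =>
      e (x.2.1 * (x.1.1 + a * p.val) - x.2.2 * (x.1.2 + a * p'.val)) :=
    measurable_e.comp (by fun_prop)
  exact (h.mul_norm_one hm.aestronglyMeasurable fun x => norm_e _).restrict _

/-- The phase that relates `modCell` on the cell `j'` with the cell `j`. -/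
def cellPhase (a b : ℝ) (j j' : Idx) (p p' : ZMod L) (x : (ℝ × ℝ) × (ℝ × ℝ)) : ℂ :=
  e (b * (j'.1.2 - j.1.2) * x.1.1 - b * (j'.2.2 - j.2.2) * x.1.2 -
    (x.2.1 * (x.1.1 + a * p.val) - x.2.2 * (x.1.2 + a * p'.val)))

omit [NeZero L] in
lemma cellPhase_mul_modCell (R : TF × TF → ℂ) (j j' : Idx) (p p' : ZMod L)
    (x : (ℝ × ℝ) × (ℝ × ℝ)) :
    cellPhase a b j j' p p' x * modCell a b R j' p p' x =
      e (b * (j'.1.2 - j.1.2) * x.1.1 - b * (j'.2.2 - j.2.2) * x.1.2) * R (place a b j' x) := by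
  rw [cellPhase, modCell, ← mul_assoc, ← e_add, sub_add_cancel]

/-- One term of the error of the reconstruction. -/
def errTerm (a b : ℝ) {Λ : Finset Idx} (c : ZMod L → ℂ) (A : Matrix Λ (ZMod L × ZMod L) ℂ)
    (R : TF × TF → ℂ) (F : Finset (ℤ × ℤ)) (i : Λ × ZMod L × ZMod L × Λ)
    (x : (ℝ × ℝ) × (ℝ × ℝ)) : ℂ :=
  A i.1 (i.2.2.1, i.2.1) * (gabor c i.2.1 (modL L i.2.2.2.1.1) *
    star (gabor c i.2.2.1 (modL L i.2.2.2.1.2))) *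
    (cellPhase a b i.1 i.2.2.2 i.2.1 i.2.2.1 x *
      residual ((icoMeasure b).prod (icoMeasure b)) (expFun₂ b)
        (fun y => modCell a b R i.2.2.2 i.2.1 i.2.2.1 (x.1, y)) F x.2)

/-- The autocorrelation of the response at `(s + a r, s' + a r')`, in terms of the autocorrelation
`R` of the spreading function. -/
def responseCorr (a b : ℝ) (Λ : Finset Idx) (c : ZMod L → ℂ) (R : TF × TF → ℂ) (s : ℝ × ℝ)
    (r r' : ℤ) : ℂ :=
  ∑ j ∈ Λ, c ((r - j.1.1 : ℤ) : ZMod L) * star (c ((r' - j.2.1 : ℤ) : ZMod L)) *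
    ∫ y, e ((y.1 + b * j.1.2) * (s.1 + a * r) - (y.2 + b * j.2.2) * (s.2 + a * r')) *
      R (place a b j (s, y)) ∂((icoMeasure b).prod (icoMeasure b))

/-- All dependence on `m` sits in one Fourier coefficient of `modCell` and its character, while the
weights `c` and the phases `n p / L` form Gabor entries. -/
lemma sample_term (hb : 0 < b) (hab : a * b = 1 / (L : ℝ)) {Λ : Finset Idx}
    (c : ZMod L → ℂ) (R : TF × TF → ℂ) (j : Idx) (p p' : ZMod L) (m : ℤ × ℤ)
    (x : (ℝ × ℝ) × (ℝ × ℝ)) :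
    e (a * b * (j.1.2 * p.val - j.2.2 * p'.val)) *
      (e (-((x.2.1 + b * j.1.2) * (x.1.1 + a * ((p.val - m.1 * L : ℤ) : ℝ)) -
        (x.2.2 + b * j.2.2) * (x.1.2 + a * ((p'.val - m.2 * L : ℤ) : ℝ)))) *
        responseCorr a b Λ c R x.1 (p.val - m.1 * L) (p'.val - m.2 * L)) =
    ∑ j' : Λ, gabor c p (modL L j'.1.1) * star (gabor c p' (modL L j'.1.2)) *
      cellPhase a b j j' p p' x * (e ((m.1 * x.2.1 - m.2 * x.2.2) / b) *
        ∫ y, modCell a b R j' p p' (x.1, y) * e (-((m.1 * y.1 - m.2 * y.2) / b))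
          ∂((icoMeasure b).prod (icoMeasure b))) := by
  rw [responseCorr, ← Finset.sum_coe_sort, Finset.mul_sum, Finset.mul_sum]
  refine Finset.sum_congr rfl fun j' _ => ?_
  rw [gabor_modL, gabor_modL]
  have hc : ∀ (p : ZMod L) (m k : ℤ), (((p.val - m * L - k : ℤ)) : ZMod L) = p - (k : ZMod L) := by
    intro p m k
    push_cast
    simp
  rw [hc, hc, star_mul', star_e]
  simp only [← integral_const_mul]
  congr 1
  ext y
  have h1 := phase_eq hb hab x.1.1 x.2.1 y.1 p.val j.1.2 j'.1.1.2 m.1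
  have h2 := phase_eq hb hab x.1.2 x.2.2 y.2 p'.val j.2.2 j'.1.2.2 m.2
  have key : e (a * b * (j.1.2 * p.val - j.2.2 * p'.val)) *
      e (-((x.2.1 + b * j.1.2) * (x.1.1 + a * ((p.val - m.1 * L : ℤ) : ℝ)) -
        (x.2.2 + b * j.2.2) * (x.1.2 + a * ((p'.val - m.2 * L : ℤ) : ℝ)))) *
      e ((y.1 + b * j'.1.1.2) * (x.1.1 + a * ((p.val - m.1 * L : ℤ) : ℝ)) -
        (y.2 + b * j'.1.2.2) * (x.1.2 + a * ((p'.val - m.2 * L : ℤ) : ℝ))) =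
      e (j'.1.1.2 * p.val / L) * e (-(j'.1.2.2 * p'.val / L)) *
        cellPhase a b j j' p p' x * e ((m.1 * x.2.1 - m.2 * x.2.2) / b) *
        e (y.1 * (x.1.1 + a * p.val) - y.2 * (x.1.2 + a * p'.val)) *
        e (-((m.1 * y.1 - m.2 * y.2) / b)) := by
    simp only [cellPhase, ← e_add]
    -- The integer is the difference of the last summands of the two instances of `phase_eq`.
    rw [← e_add_int (_ + _ + _ + _ + _ + _)
      (m.1 * (j.1.2 - j'.1.1.2) - m.2 * (j.2.2 - j'.1.2.2))]
    congr 1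
    push_cast at h1 h2 ⊢
    linear_combination h1 - h2
  simp only [modCell]
  linear_combination (c (p - (j'.1.1.1 : ZMod L)) * star (c (p' - (j'.1.2.1 : ZMod L))) *
    R (place a b j' (x.1, y))) * key

end Reconstruction

/-! ### The reconstruction error as a finite sum of Fourier residuals -/

section Reconstruction

variable {a b : ℝ} {L : ℕ} [NeZero L] {Λ : Finset Idx} {c : ZMod L → ℂ}
  {A : Matrix Λ (ZMod L × ZMod L) ℂ}

omit [NeZero L] in
lemma samplePt_eq (t : ℝ) (k m : ℤ) (p : ZMod L) :
    samplePt a L t k m p = t - a * k + a * ((p.val - m * L : ℤ) : ℝ) := by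
  rw [samplePt]
  push_cast
  ring

/-- The left inverse writes `R q` as the same combination of values of `modCell` whose Fourier
partial sums occur in the series, so the two sides subtract term by term. -/
lemma sub_recon_cell (hb : 0 < b) (hab : a * b = 1 / (L : ℝ)) (hA : A * gaborTensor c Λ = 1)
    {R : TF × TF → ℂ} {Rf : ℝ × ℝ → ℂ} {q : TF × TF} (j : Λ)
    (hRf : ∀ r r' : ℤ, Rf ((unplace a b j q).1.1 + a * r, (unplace a b j q).1.2 + a * r') =
      responseCorr a b Λ c R (unplace a b j q).1 r r')
    (F : Finset (ℤ × ℤ)) :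
    R q - ((b : ℂ) ^ 2)⁻¹ * ∑ p : ZMod L, ∑ p' : ZMod L,
      A j (p', p) * e (a * b * (j.1.1.2 * p.val - j.1.2.2 * p'.val)) *
        ∑ m ∈ F, e (-(q.1.2 * samplePt a L q.1.1 j.1.1.1 m.1 p
              - q.2.2 * samplePt a L q.2.1 j.1.2.1 m.2 p')) *
            Rf (samplePt a L q.1.1 j.1.1.1 m.1 p, samplePt a L q.2.1 j.1.2.1 m.2 p') =
    ∑ p : ZMod L, ∑ p' : ZMod L, ∑ j' : Λ,
      errTerm a b c A R F (j, p, p', j') (unplace a b j q) := by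
  set x := unplace a b j q with hx
  have hR : R q = ∑ p : ZMod L, ∑ p' : ZMod L, ∑ j' : Λ,
      A j (p', p) * (gabor c p (modL L j'.1.1) * star (gabor c p' (modL L j'.1.2))) *
        (cellPhase a b j j' p p' x * modCell a b R j' p p' x) := by
    simp only [cellPhase_mul_modCell]
    -- The sum over `j'` against the Kronecker delta is inserted so that `sum_leftInverse` can
    -- expand the delta; the phase is trivial at `j' = j`.
    calc R q = ∑ j' : Λ, (if j = j' then 1 else 0) *
          (e (b * (j'.1.1.2 - j.1.1.2) * x.1.1 - b * (j'.1.2.2 - j.1.2.2) * x.1.2) *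
            R (place a b j' x)) := by
          simp [hx, place_unplace, e_zero]
      _ = _ := by
          simp only [← sum_leftInverse hA, Finset.sum_mul]
          rw [Finset.sum_comm]
          exact Finset.sum_congr rfl fun p _ => Finset.sum_comm
  have hq1 : q.1.2 = x.2.1 + b * j.1.1.2 := by simp [hx, unplace]
  have hq2 : q.2.2 = x.2.2 + b * j.1.2.2 := by simp [hx, unplace]
  have hS : ∀ p p' : ZMod L,
      A j (p', p) * e (a * b * (j.1.1.2 * p.val - j.1.2.2 * p'.val)) *
        ∑ m ∈ F, e (-(q.1.2 * samplePt a L q.1.1 j.1.1.1 m.1 p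
              - q.2.2 * samplePt a L q.2.1 j.1.2.1 m.2 p')) *
            Rf (samplePt a L q.1.1 j.1.1.1 m.1 p, samplePt a L q.2.1 j.1.2.1 m.2 p') =
      ∑ j' : Λ, A j (p', p) * (gabor c p (modL L j'.1.1) * star (gabor c p' (modL L j'.1.2))) *
        (cellPhase a b j j' p p' x * ∑ m ∈ F, e ((m.1 * x.2.1 - m.2 * x.2.2) / b) *
        ∫ y, modCell a b R j' p p' (x.1, y) * e (-((m.1 * y.1 - m.2 * y.2) / b))
          ∂((icoMeasure b).prod (icoMeasure b))) := by
    intro p p'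
    simp only [Finset.mul_sum]
    rw [Finset.sum_comm]
    refine Finset.sum_congr rfl fun m _ => ?_
    have h1 : samplePt a L q.1.1 j.1.1.1 m.1 p = x.1.1 + a * ((p.val - m.1 * L : ℤ) : ℝ) :=
      samplePt_eq _ _ _ _
    have h2 : samplePt a L q.2.1 j.1.2.1 m.2 p' = x.1.2 + a * ((p'.val - m.2 * L : ℤ) : ℝ) :=
      samplePt_eq _ _ _ _
    rw [h1, h2, hRf, hq1, hq2, mul_assoc, sample_term hb hab, Finset.mul_sum]
    refine Finset.sum_congr rfl fun j' _ => ?_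
    ring
  simp only [hS]
  rw [hR]
  simp only [Finset.mul_sum (s := (Finset.univ : Finset (ZMod L))), ← Finset.sum_sub_distrib]
  refine Finset.sum_congr rfl fun p _ => Finset.sum_congr rfl fun p' _ => ?_
  rw [Finset.mul_sum, ← Finset.sum_sub_distrib]
  refine Finset.sum_congr rfl fun j' _ => ?_
  rw [errTerm, residual_expFun₂ hb]
  ring

/-- The cells are disjoint, so at most one is active at `q`; off their union both `R q` and the
partial sum vanish. -/
lemma sub_reconPartial (ha : 0 < a) (hb : 0 < b) (hab : a * b = 1 / (L : ℝ))
    (hA : A * gaborTensor c Λ = 1) {R : TF × TF → ℂ} {Rf : ℝ × ℝ → ℂ} {q : TF × TF}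
    (hR : q ∉ cover a b Λ → R q = 0)
    (hRf : ∀ j ∈ Λ, q ∈ cell a b j → ∀ r r' : ℤ,
      Rf ((unplace a b j q).1.1 + a * r, (unplace a b j q).1.2 + a * r') =
        responseCorr a b Λ c R (unplace a b j q).1 r r')
    (F : Finset (ℤ × ℤ)) :
    R q - reconPartial a b Λ A Rf F q = ∑ i : Λ × ZMod L × ZMod L × Λ,
      (box a b).indicator (errTerm a b c A R F i) (unplace a b i.1 q) := by
  have hRq : R q = ∑ j : Λ, (cell a b j.1).indicator (fun _ => (1 : ℂ)) q * R q := by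
    by_cases hq : q ∈ cover a b Λ
    · simp only [cover, Set.mem_iUnion] at hq
      obtain ⟨j, hj, hqj⟩ := hq
      rw [Finset.sum_eq_single (⟨j, hj⟩ : Λ)]
      · simp [hqj]
      · intro j' _ hne
        rw [Set.indicator_of_notMem, zero_mul]
        exact fun h => hne (Subtype.ext (cell_injective ha hb h hqj))
      · simp
    · simp [hR hq]
  rw [Fintype.sum_prod_type]
  nth_rewrite 1 [hRq]
  rw [reconPartial, Finset.mul_sum, ← Finset.sum_sub_distrib]
  refine Finset.sum_congr rfl fun j _ => ?_
  by_cases hq : q ∈ cell a b j.1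
  · have hbox := unplace_mem_box.2 hq
    simp only [Set.indicator_of_mem hq, Set.indicator_of_mem hbox, one_mul]
    rw [sub_recon_cell hb hab hA j (hRf j j.2 hq) F]
    simp only [Fintype.sum_prod_type]
  · have hbox : unplace a b j q ∉ box a b := fun h => hq (unplace_mem_box.1 h)
    simp [Set.indicator_of_notMem hq, Set.indicator_of_notMem hbox]

omit [NeZero L] in
lemma aestronglyMeasurable_errTerm (hb : 0 < b) {R : TF × TF → ℂ} (hR : MemLp R 2 volume)
    (F : Finset (ℤ × ℤ)) (i : Λ × ZMod L × ZMod L × Λ) :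
    AEStronglyMeasurable (errTerm a b c A R F i) (volume.restrict (box a b)) := by
  rw [volume_restrict_box]
  refine AEStronglyMeasurable.const_mul (AEStronglyMeasurable.mul ?_ ?_) _
  · exact (measurable_e.comp (by fun_prop)).aestronglyMeasurable
  · exact (isONB_expFun₂ hb).aestronglyMeasurable_residual (memLp_modCell hR _ _ _).1 F

omit [NeZero L] in
-- `unplace` preserves measure and `cellPhase` is unimodular, so only a constant times a Fourier
-- residual on the box remains.
lemma tendsto_errTerm (hb : 0 < b) {R : TF × TF → ℂ} (hR : MemLp R 2 volume)
    (i : Λ × ZMod L × ZMod L × Λ) :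
    Tendsto (fun F => eLpNorm (fun q : TF × TF => (box a b).indicator (errTerm a b c A R F i)
      (unplace a b i.1 q)) 2 volume) atTop (𝓝 0) := by
  set C := A i.1 (i.2.2.1, i.2.1) * (gabor c i.2.1 (modL L i.2.2.2.1.1) *
    star (gabor c i.2.2.1 (modL L i.2.2.2.1.2))) with hC
  have h0 := (isONB_expFun₂ hb).tendsto_residual_prod
    (memLp_modCell (a := a) hR (i.2.2.2 : Idx) i.2.1 i.2.2.1)
  have h1 := ENNReal.Tendsto.const_mul (a := ‖C‖ₑ) h0 (Or.inr enorm_ne_top)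
  rw [mul_zero] at h1
  refine tendsto_of_tendsto_of_tendsto_of_le_of_le tendsto_const_nhds h1
    (fun _ => zero_le) fun F => ?_
  have hm := aestronglyMeasurable_errTerm (a := a) (c := c) (A := A) hb hR F i
  calc _ = eLpNorm ((box a b).indicator (errTerm a b c A R F i)) 2 volume :=
        eLpNorm_comp_measurePreserving ((aestronglyMeasurable_indicator_iff
          (measurableSet_box a b)).2 hm) (measurePreserving_unplace a b i.1)
    _ = eLpNorm (errTerm a b c A R F i) 2 (volume.restrict (box a b)) :=
        eLpNorm_indicator_eq_eLpNorm_restrict (measurableSet_box a b)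
    _ ≤ _ := by
        rw [volume_restrict_box, ← eLpNorm_const_smul]
        refine eLpNorm_mono fun x => ?_
        simp only [errTerm, ← hC, Pi.smul_apply, smul_eq_mul, norm_mul, cellPhase, norm_e, one_mul]
        exact le_rfl

/-- The reconstruction formula, in terms of the autocorrelations of the spreading function and of
the response. -/
theorem tendsto_reconPartial (ha : 0 < a) (hb : 0 < b) (hab : a * b = 1 / (L : ℝ))
    (hA : A * gaborTensor c Λ = 1) {R : TF × TF → ℂ} (hR : MemLp R 2 volume)
    (hR0 : ∀ᵐ q, q ∉ cover a b Λ → R q = 0) {Rf : ℝ × ℝ → ℂ}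
    (hRf : ∀ᵐ s ∂((icoMeasure a).prod (icoMeasure a)), ∀ r r' : ℤ,
      Rf (s.1 + a * r, s.2 + a * r') = responseCorr a b Λ c R s r r') :
    Tendsto (fun F => eLpNorm (fun q => R q - reconPartial a b Λ A Rf F q) 2 volume)
      atTop (𝓝 0) := by
  have hgood : ∀ᵐ x : (ℝ × ℝ) × (ℝ × ℝ), x ∈ box a b → ∀ r r' : ℤ,
      Rf (x.1.1 + a * r, x.1.2 + a * r') = responseCorr a b Λ c R x.1 r r' := by
    rw [← ae_restrict_iff' (measurableSet_box a b), volume_restrict_box]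
    exact Measure.quasiMeasurePreserving_fst.ae hRf
  have hgood' : ∀ᵐ q : TF × TF, ∀ j ∈ Λ, q ∈ cell a b j → ∀ r r' : ℤ,
      Rf ((unplace a b j q).1.1 + a * r, (unplace a b j q).1.2 + a * r') =
        responseCorr a b Λ c R (unplace a b j q).1 r r' := by
    refine (ae_ball_iff Λ.countable_toSet).2 fun j _ => ?_
    filter_upwards [(measurePreserving_unplace a b j).quasiMeasurePreserving.ae hgood] with q hq h
    exact hq (unplace_mem_box.2 h)
  have hsum : Tendsto (fun F => ∑ i : Λ × ZMod L × ZMod L × Λ,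
      eLpNorm (fun q : TF × TF => (box a b).indicator (errTerm a b c A R F i)
        (unplace a b i.1 q)) 2 volume) atTop (𝓝 0) := by
    have := tendsto_finsetSum Finset.univ fun i (_ : i ∈ (Finset.univ :
      Finset (Λ × ZMod L × ZMod L × Λ))) => tendsto_errTerm (a := a) (c := c) (A := A) hb hR i
    simpa using this
  refine tendsto_of_tendsto_of_tendsto_of_le_of_le tendsto_const_nhds hsum
    (fun _ => zero_le) fun F => ?_
  have heq : (fun q => R q - reconPartial a b Λ A Rf F q) =ᵐ[volume]
      ∑ i : Λ × ZMod L × ZMod L × Λ, fun q : TF × TF =>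
        (box a b).indicator (errTerm a b c A R F i) (unplace a b i.1 q) := by
    filter_upwards [hR0, hgood'] with q h1 h2
    rw [sub_reconPartial ha hb hab hA h1 h2, Finset.sum_apply]
  simp only
  rw [eLpNorm_congr_ae heq]
  refine eLpNorm_sum_le (fun i _ => ?_) (by norm_num)
  exact ((aestronglyMeasurable_indicator_iff (measurableSet_box a b)).2
    (aestronglyMeasurable_errTerm hb hR F i)).comp_measurePreserving
    (measurePreserving_unplace a b i.1)

end Reconstruction

/-! ### The response to a delta train -/

lemma IsResponse.congr_ae {η η' : TF → ℂ} {u : Functional} {g : ℝ → ℂ} (h : IsResponse η u g)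
    (hη : η =ᵐ[volume] η') : IsResponse η' u g := by
  have he : ∀ φ, (fun z => η z * tfShift z u φ) =ᵐ[volume] fun z => η' z * tfShift z u φ := by
    intro φ
    filter_upwards [hη] with z hz
    rw [hz]
  exact ⟨h.1, fun φ h1 h2 => (h.2 φ h1 h2).congr (he φ),
    fun φ h1 h2 => (h.3 φ h1 h2).trans (integral_congr_ae (he φ))⟩

lemma integrable_mul_testFunction {g φ : ℝ → ℂ} (hg : LocallyIntegrable g volume)
    (h1 : ContDiff ℝ (⊤ : ℕ∞) φ) (h2 : HasCompactSupport φ) :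
    Integrable (fun x => g x * φ x) volume := by
  have := hg.integrable_smul_left_of_hasCompactSupport h1.continuous h2
  refine this.congr (ae_of_all _ fun x => ?_)
  simp [mul_comm]

lemma IsResponse.sum {ι : Type*} {W : Finset ι} {η : ι → TF → ℂ} {u : Functional}
    {g : ι → ℝ → ℂ} (h : ∀ i ∈ W, IsResponse (η i) u (g i)) :
    IsResponse (fun z => ∑ i ∈ W, η i z) u (fun x => ∑ i ∈ W, g i x) := by
  refine ⟨?_, fun φ h1 h2 => ?_, fun φ h1 h2 => ?_⟩
  · have := locallyIntegrable_finsetSum W fun i hi => (h i hi).1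
    simpa using this
  · simp only [Finset.sum_mul]
    exact integrable_finsetSum W fun i hi => (h i hi).2 φ h1 h2
  · simp only [Finset.sum_mul]
    rw [integral_finsetSum W fun i hi => (h i hi).2 φ h1 h2,
      integral_finsetSum W fun i hi => integrable_mul_testFunction (h i hi).1 h1 h2]
    exact Finset.sum_congr rfl fun i hi => (h i hi).3 φ h1 h2

lemma IsResponse.ae_eq {η : TF → ℂ} {u : Functional} {g g' : ℝ → ℂ} (h : IsResponse η u g)
    (h' : IsResponse η u g') : g =ᵐ[volume] g' := by
  refine ae_eq_of_integral_contDiff_smul_eq h.1 h'.1 fun φ h1 h2 => ?_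
  have h3 : ContDiff ℝ (⊤ : ℕ∞) fun x => (φ x : ℂ) := Complex.ofRealCLM.contDiff.comp h1
  have h4 : HasCompactSupport fun x => (φ x : ℂ) := h2.comp_left (g := Complex.ofReal) (by simp)
  have h5 := (h.3 _ h3 h4).trans (h'.3 _ h3 h4).symm
  simpa [mul_comm] using h5

/-! ### Spreading functions supported on one time strip -/

section Cell

variable {a b : ℝ} {L : ℕ}

/-- The contribution of the sample `k` of the delta train to the response. -/
def trainTerm (a : ℝ) (c : ZMod L → ℂ) (h : TF → ℂ) (k : ℤ) (x : ℝ) : ℂ :=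
  c k * ∫ ν, e (ν * x) * h (x - a * k, ν)

/-- The response to a delta train of an operator whose spreading function is supported on
`[a κ, a κ + a) × ℝ`. -/
def stripResponse (a : ℝ) (c : ZMod L → ℂ) (h : TF → ℂ) (κ : ℤ) (x : ℝ) : ℂ :=
  trainTerm a c h (⌊x / a⌋ - κ) x

lemma integrable_train {h : TF → ℂ} (hh : Integrable h volume) (k : ℤ) :
    Integrable (fun z : TF => e (z.2 * z.1) * h (z.1 - a * k, z.2)) volume := by
  have hmp : MeasurePreserving (fun z : TF => (z.1 - a * k, z.2)) volume volume :=
    (measurePreserving_sub_right volume (a * k)).prod (MeasurePreserving.id volume)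
  have h1 : Integrable (fun z : TF => h (z.1 - a * k, z.2)) volume :=
    hmp.integrable_comp_of_integrable hh
  refine h1.bdd_mul (c := 1) (measurable_e.comp (by fun_prop)).aestronglyMeasurable
    (ae_of_all _ fun z => (norm_e _).le)

lemma integrable_trainTerm {h : TF → ℂ} (hh : Integrable h volume) (c : ZMod L → ℂ) (k : ℤ) :
    Integrable (trainTerm a c h k) volume :=
  (Integrable.integral_prod_left (integrable_train (a := a) hh k)).const_mul _

lemma floor_add_intMul {t : ℝ} (ha : 0 < a) (k : ℤ) : ⌊(t - a * k) / a⌋ = ⌊t / a⌋ - k := by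
  rw [sub_div, mul_div_cancel_left₀ _ ha.ne', Int.floor_sub_intCast]

/-- The indices of the samples that contribute on `[-M, M]`. -/
def trainRange (a M : ℝ) (κ : ℤ) : Finset ℤ := Finset.Icc (⌊-M / a⌋ - κ) (⌊M / a⌋ - κ)

lemma mem_trainRange (ha : 0 < a) {M x : ℝ} (hx : |x| ≤ M) (κ : ℤ) :
    ⌊x / a⌋ - κ ∈ trainRange a M κ := by
  rw [abs_le] at hx
  rw [trainRange, Finset.mem_Icc]
  constructor
  · gcongr
    exact hx.1
  · gcongr
    exact hx.2

/-- For any `k` other than `⌊x / a⌋ - κ` the point `x - a k` misses the strip, so the added terms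
are zero. The index set no longer depends on `x`, which makes integrability on bounded sets evident.
-/
lemma stripResponse_eq_sum (ha : 0 < a) {h : TF → ℂ} {κ : ℤ}
    (h0 : ∀ z : TF, ⌊z.1 / a⌋ ≠ κ → h z = 0) (c : ZMod L → ℂ) {M x : ℝ} (hx : |x| ≤ M) :
    stripResponse a c h κ x = ∑ k ∈ trainRange a M κ, trainTerm a c h k x := by
  rw [Finset.sum_eq_single_of_mem _ (mem_trainRange ha hx κ)]
  · rfl
  · intro k _ hk
    have : ∀ ν, h (x - a * k, ν) = 0 := fun ν => h0 _ (by
      simp only [floor_add_intMul ha]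
      omega)
    simp [trainTerm, this]

/-- On the strip, `φ (a k + t) ≠ 0` forces `|a k + t| ≤ M` and so confines `k` to a finite set
independent of `z`. -/
lemma mul_tfShift_eq_sum (ha : 0 < a) {h : TF → ℂ} {κ : ℤ}
    (h0 : ∀ z : TF, ⌊z.1 / a⌋ ≠ κ → h z = 0) (c : ZMod L → ℂ) {M : ℝ} {φ : ℝ → ℂ}
    (hφ : ∀ x, M < |x| → φ x = 0) (z : TF) :
    h z * tfShift z (deltaTrain a c) φ = ∑ k ∈ trainRange a M κ,
      h z * (c k * (e (z.2 * (a * k + z.1)) * φ (a * k + z.1))) := by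
  by_cases hz : ⌊z.1 / a⌋ = κ
  · rw [← Finset.mul_sum]
    congr 1
    refine tsum_eq_sum fun k hk => ?_
    beta_reduce
    rw [hφ (a * k + z.1), mul_zero, mul_zero]
    by_contra! hlt
    apply hk
    have := mem_trainRange ha hlt κ
    rwa [add_div, mul_div_cancel_left₀ _ ha.ne', Int.floor_intCast_add, hz,
      add_sub_cancel_right] at this
  · simp [h0 z hz]

/-- Translate the time variable by `a k`, then apply Fubini. -/
lemma integral_trainTerm_mul {h : TF → ℂ} (hh : Integrable h volume) (c : ZMod L → ℂ) {φ : ℝ → ℂ}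
    (h1 : Continuous φ) (h2 : HasCompactSupport φ) (k : ℤ) :
    Integrable (fun z : TF => h z * (c k * (e (z.2 * (a * k + z.1)) * φ (a * k + z.1)))) volume ∧
    ∫ x, trainTerm a c h k x * φ x =
      ∫ z : TF, h z * (c k * (e (z.2 * (a * k + z.1)) * φ (a * k + z.1))) := by
  have hmp : MeasurePreserving (fun z : TF => (z.1 + a * k, z.2)) volume volume :=
    (measurePreserving_add_right volume (a * k)).prod (MeasurePreserving.id volume)
  have hemb : MeasurableEmbedding (fun z : TF => (z.1 + a * k, z.2)) :=
    (measurableEmbedding_addRight (a * (k : ℝ))).prodMap MeasurableEmbedding.id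
  obtain ⟨B, hB⟩ := h2.exists_bound_of_continuous h1
  have hint : Integrable (fun z : TF => c k * (φ z.1 * (e (z.2 * z.1) * h (z.1 - a * k, z.2))))
      volume := by
    refine Integrable.const_mul ?_ _
    exact (integrable_train hh k).bdd_mul (c := B) (h1.comp continuous_fst).aestronglyMeasurable
      (ae_of_all _ fun z => hB _)
  have hcomp : ∀ z : TF, h z * (c k * (e (z.2 * (a * k + z.1)) * φ (a * k + z.1))) =
      (fun z : TF => c k * (φ z.1 * (e (z.2 * z.1) * h (z.1 - a * k, z.2))))
        (z.1 + a * k, z.2) := by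
    intro z
    simp only [add_sub_cancel_right]
    rw [add_comm z.1]
    ring
  refine ⟨?_, ?_⟩
  · simp only [hcomp]
    exact hmp.integrable_comp_of_integrable hint
  · simp only [hcomp]
    rw [hmp.integral_comp hemb (fun z : TF => c k * (φ z.1 * (e (z.2 * z.1) *
      h (z.1 - a * k, z.2)))), Measure.volume_eq_prod, integral_prod _ hint]
    congr 1
    ext x
    simp only [integral_const_mul, trainTerm]
    ring

lemma isResponse_strip (ha : 0 < a) {h : TF → ℂ} (hh : Integrable h volume) {κ : ℤ}
    (h0 : ∀ z : TF, ⌊z.1 / a⌋ ≠ κ → h z = 0) (c : ZMod L → ℂ) :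
    IsResponse h (deltaTrain a c) (stripResponse a c h κ) := by
  have hbound : ∀ φ : ℝ → ℂ, HasCompactSupport φ → ∃ M, ∀ x, M < |x| → φ x = 0 := by
    intro φ hφ
    obtain ⟨M, hM⟩ := hφ.isCompact.isBounded.exists_norm_le
    refine ⟨M, fun x hx => image_eq_zero_of_notMem_tsupport fun hmem => ?_⟩
    exact absurd (hM x hmem) (not_le.2 hx)
  refine ⟨?_, fun φ h1 h2 => ?_, fun φ h1 h2 => ?_⟩
  · rw [locallyIntegrable_iff]
    intro K hK
    obtain ⟨M, hM⟩ := hK.isBounded.exists_norm_le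
    have h1 : IntegrableOn (fun x => ∑ k ∈ trainRange a M κ, trainTerm a c h k x) K volume :=
      (integrable_finsetSum _ fun k _ => integrable_trainTerm hh c k).integrableOn
    exact h1.congr_fun (fun x hx => (stripResponse_eq_sum ha h0 c (hM x hx)).symm)
      hK.measurableSet
  · obtain ⟨M, hM⟩ := hbound φ h2
    simp only [mul_tfShift_eq_sum ha h0 c hM]
    exact integrable_finsetSum _ fun k _ => (integral_trainTerm_mul hh c h1.continuous h2 k).1
  · obtain ⟨M, hM⟩ := hbound φ h2
    simp only [mul_tfShift_eq_sum ha h0 c hM]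
    rw [integral_finsetSum _ fun k _ => (integral_trainTerm_mul hh c h1.continuous h2 k).1]
    obtain ⟨B, hB⟩ := h2.exists_bound_of_continuous h1.continuous
    have he : ∀ x, stripResponse a c h κ x * φ x =
        ∑ k ∈ trainRange a M κ, trainTerm a c h k x * φ x := by
      intro x
      by_cases hx : |x| ≤ M
      · rw [stripResponse_eq_sum ha h0 c hx, Finset.sum_mul]
      · simp [hM x (not_le.1 hx)]
    simp only [he]
    rw [integral_finsetSum _ fun k _ => ?_]
    · exact Finset.sum_congr rfl fun k _ => (integral_trainTerm_mul hh c h1.continuous h2 k).2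
    · exact (integrable_trainTerm hh c k).mul_bdd (c := B) h1.continuous.aestronglyMeasurable
        (ae_of_all _ hB)

end Cell

/-! ### The response of finitely many cells and its autocorrelation -/

section Response

variable {a b : ℝ} {L : ℕ} {c : ZMod L → ℂ} {W : Finset (ℤ × ℤ)}

/-- The cell of the time-frequency plane with index `l`. -/
def tfCell (a b : ℝ) (l : ℤ × ℤ) : Set TF := {z | (z.1 - a * l.1, z.2 - b * l.2) ∈ rect a b}

lemma measurableSet_tfCell (a b : ℝ) (l : ℤ × ℤ) : MeasurableSet (tfCell a b l) :=
  (measurableSet_Ico.prod measurableSet_Ico).preimage (by fun_prop)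

lemma volume_tfCell_lt_top (a b : ℝ) (l : ℤ × ℤ) : volume (tfCell a b l) < ⊤ := by
  have h : MeasurePreserving (fun z : TF => (z.1 - a * l.1, z.2 - b * l.2)) volume volume :=
    (measurePreserving_sub_right volume (a * (l.1 : ℝ))).prod
      (measurePreserving_sub_right volume (b * (l.2 : ℝ)))
  have h2 := h.measure_preimage (s := rect a b)
    (measurableSet_Ico.prod measurableSet_Ico).nullMeasurableSet
  change volume ((fun z : TF => (z.1 - a * l.1, z.2 - b * l.2)) ⁻¹' rect a b) < ⊤
  rw [h2, rect, Measure.volume_eq_prod, Measure.prod_prod]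
  simp [ENNReal.mul_lt_top]

lemma mem_tfCell_iff (ha : 0 < a) (hb : 0 < b) {l : ℤ × ℤ} {z : TF} :
    z ∈ tfCell a b l ↔ l = (⌊z.1 / a⌋, ⌊z.2 / b⌋) := by
  constructor
  · rintro ⟨h1, h2⟩
    exact Prod.ext (floor_div_eq ha h1).symm (floor_div_eq hb h2).symm
  · rintro rfl
    have key : ∀ {d t : ℝ}, 0 < d → t - d * ⌊t / d⌋ ∈ Set.Ico 0 d := by
      intro d t hd
      have h1 := Int.floor_le (t / d)
      have h2 := Int.lt_floor_add_one (t / d)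
      rw [le_div_iff₀ hd] at h1
      rw [div_lt_iff₀ hd] at h2
      constructor <;> nlinarith
    exact ⟨key ha, key hb⟩

/-- The response to the delta train of an operator with a spreading function that is supported on
the cells with index in `W`. -/
def cellsResponse (a b : ℝ) (c : ZMod L → ℂ) (W : Finset (ℤ × ℤ)) (h : TF → ℂ) (x : ℝ) : ℂ :=
  ∑ l ∈ W, c ((⌊x / a⌋ - l.1 : ℤ) : ZMod L) * ∫ y, e ((y + b * l.2) * x) *
    h (x - a * ⌊x / a⌋ + a * l.1, y + b * l.2) ∂(icoMeasure b)

lemma stripResponse_indicator (ha : 0 < a) (h : TF → ℂ) (l : ℤ × ℤ) (x : ℝ) :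
    stripResponse a c ((tfCell a b l).indicator h) l.1 x =
      c ((⌊x / a⌋ - l.1 : ℤ) : ZMod L) * ∫ y, e ((y + b * l.2) * x) *
        h (x - a * ⌊x / a⌋ + a * l.1, y + b * l.2) ∂(icoMeasure b) := by
  rw [stripResponse, trainTerm]
  congr 1
  have ht : x - a * ((⌊x / a⌋ - l.1 : ℤ) : ℝ) = x - a * ⌊x / a⌋ + a * l.1 := by
    push_cast
    ring
  rw [ht, ← integral_add_right_eq_self _ (b * (l.2 : ℝ)), ← integral_indicator measurableSet_Ico]
  congr 1
  ext y
  have hx : x - a * ⌊x / a⌋ ∈ Set.Ico 0 a := by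
    have h1 := Int.floor_le (x / a)
    have h2 := Int.lt_floor_add_one (x / a)
    rw [le_div_iff₀ ha] at h1
    rw [div_lt_iff₀ ha] at h2
    constructor <;> nlinarith
  have hiff : (x - a * ⌊x / a⌋ + a * l.1, y + b * l.2) ∈ tfCell a b l ↔ y ∈ Set.Ico 0 b := by
    simp only [tfCell, rect, Set.mem_ofPred_eq, Set.mem_prod, add_sub_cancel_right]
    exact and_iff_right hx
  by_cases hy : y ∈ Set.Ico 0 b
  · rw [Set.indicator_of_mem (hiff.2 hy), Set.indicator_of_mem hy]
  · rw [Set.indicator_of_notMem fun h => hy (hiff.1 h), Set.indicator_of_notMem hy, mul_zero]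

/-- Each cell has finite measure, so an `L²` spreading function is integrable there and the strip
formula applies cell by cell. -/
lemma isResponse_cells (ha : 0 < a) (hb : 0 < b) {h : TF → ℂ} (hh : MemLp h 2 volume)
    (h0 : ∀ᵐ z : TF, (⌊z.1 / a⌋, ⌊z.2 / b⌋) ∉ W → h z = 0) (c : ZMod L → ℂ) :
    IsResponse h (deltaTrain a c) (cellsResponse a b c W h) := by
  have h1 : ∀ l ∈ W, IsResponse ((tfCell a b l).indicator h) (deltaTrain a c)
      (stripResponse a c ((tfCell a b l).indicator h) l.1) := by
    intro l _
    refine isResponse_strip ha ?_ (fun z hz => Set.indicator_of_notMem ?_ _) c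
    · rw [integrable_indicator_iff (measurableSet_tfCell a b l)]
      have : IsFiniteMeasure (volume.restrict (tfCell a b l)) :=
        ⟨by simpa using volume_tfCell_lt_top a b l⟩
      exact (hh.restrict _).integrable (by norm_num)
    · intro hmem
      rw [mem_tfCell_iff ha hb] at hmem
      exact hz (by rw [hmem])
  have h2 := (IsResponse.sum h1).congr_ae (η' := h) ?_
  · refine (congrArg (IsResponse h (deltaTrain a c)) ?_).mp h2
    ext x
    simp only [stripResponse_indicator ha, cellsResponse]
  · filter_upwards [h0] with z hz
    by_cases hW : (⌊z.1 / a⌋, ⌊z.2 / b⌋) ∈ W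
    · rw [Finset.sum_eq_single_of_mem _ hW]
      · exact Set.indicator_of_mem ((mem_tfCell_iff ha hb).2 rfl) _
      · intro l _ hl
        exact Set.indicator_of_notMem (fun hmem => hl ((mem_tfCell_iff ha hb).1 hmem)) _
    · rw [hz hW]
      refine Finset.sum_eq_zero fun l _ => ?_
      simp [Set.indicator, hz hW]

variable {Ω : Type*} [MeasurableSpace Ω] {P : Measure Ω} [SFinite P]

lemma stronglyMeasurable_cellsResponse {H : Ω × TF → ℂ} (hH : StronglyMeasurable H) :
    StronglyMeasurable fun q : Ω × ℝ => cellsResponse a b c W (fun z => H (q.1, z)) q.2 := by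
  refine Finset.stronglyMeasurable_fun_sum W fun l _ => StronglyMeasurable.mul ?_ ?_
  · have hf : Measurable fun q : Ω × ℝ => ⌊q.2 / a⌋ - l.1 :=
      (Int.measurable_floor.comp (by fun_prop)).sub_const _
    exact ((measurable_of_countable fun k : ℤ => c k).comp hf).stronglyMeasurable
  · refine StronglyMeasurable.integral_prod_right (f := fun (q : Ω × ℝ) (y : ℝ) =>
      e ((y + b * l.2) * q.2) * H (q.1, (q.2 - a * ⌊q.2 / a⌋ + a * l.1, y + b * l.2))) ?_
    refine StronglyMeasurable.mul ?_ (hH.comp_measurable ?_)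
    · exact (measurable_e.comp (by fun_prop)).stronglyMeasurable
    · have hf : Measurable fun q : (Ω × ℝ) × ℝ => ((⌊q.1.2 / a⌋ : ℤ) : ℝ) :=
        (measurable_of_countable fun k : ℤ => (k : ℝ)).comp
          (Int.measurable_floor.comp (by fun_prop))
      fun_prop

/-- The slice of the process `H` at time `s + a l.1`, on the frequency band with index `l.2`. -/
def slice (a b : ℝ) (H : Ω × TF → ℂ) (l : ℤ × ℤ) (s : ℝ) (q : Ω × ℝ) : ℂ :=
  H (q.1, (s + a * l.1, q.2 + b * l.2))

/-- With time moved to the outermost variable, Fubini gives almost every time slice finite energy in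
outcome and frequency. -/
lemma ae_memLp_slice {H : Ω × TF → ℂ} (hH : MemLp H 2 (P.prod volume)) (l : ℤ × ℤ) :
    ∀ᵐ s : ℝ, MemLp (slice a b H l s) 2 (P.prod (icoMeasure b)) := by
  have hswap : MeasurePreserving (fun q : ℝ × (Ω × ℝ) => (q.2.1, (q.1, q.2.2)))
      ((volume : Measure ℝ).prod (P.prod (volume : Measure ℝ)))
      (P.prod ((volume : Measure ℝ).prod (volume : Measure ℝ))) := by
    have h1 := measurePreserving_assoc_left (P := (volume : Measure ℝ)) (μ := P)
      (μ' := (volume : Measure ℝ))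
    have h2 : MeasurePreserving (fun q : (ℝ × Ω) × ℝ => ((q.1.2, q.1.1), q.2))
        (((volume : Measure ℝ).prod P).prod (volume : Measure ℝ))
        ((P.prod (volume : Measure ℝ)).prod (volume : Measure ℝ)) :=
      (Measure.measurePreserving_swap).prod (MeasurePreserving.id _)
    exact (measurePreserving_prodAssoc P volume volume).comp (h2.comp h1)
  have htr : MeasurePreserving (fun q : Ω × (ℝ × ℝ) => (q.1, (q.2.1 + a * l.1, q.2.2 + b * l.2)))
      (P.prod volume) (P.prod volume) :=
    (MeasurePreserving.id P).prod
      ((measurePreserving_add_right volume (a * (l.1 : ℝ))).prod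
        (measurePreserving_add_right volume (b * (l.2 : ℝ))))
  have h := ae_memLp_right (hH.comp_measurePreserving (htr.comp hswap))
  filter_upwards [h] with s hs
  exact hs.mono_measure (Measure.prod_mono le_rfl Measure.restrict_le_self)

lemma memLp_e_mul (x : ℝ) (n : ℤ) : MemLp (fun y => e ((y + b * n) * x)) 2 (icoMeasure b) := by
  refine MemLp.of_bound (measurable_e.comp (by fun_prop)).aestronglyMeasurable 1
    (ae_of_all _ fun y => (norm_e _).le)

omit [MeasurableSpace Ω] in
lemma cellsResponse_add (ha : 0 < a) (H : Ω × TF → ℂ) (ω : Ω) {s : ℝ} (hs : s ∈ Set.Ico 0 a)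
    (r : ℤ) : cellsResponse a b c W (fun z => H (ω, z)) (s + a * r) =
      ∑ l ∈ W, c ((r - l.1 : ℤ) : ZMod L) *
        ∫ y, e ((y + b * l.2) * (s + a * r)) * slice a b H l s (ω, y) ∂(icoMeasure b) := by
  have hr : ⌊(s + a * r) / a⌋ = r := floor_div_eq ha (by simpa using hs)
  simp only [cellsResponse, hr, add_sub_cancel_right, slice]

lemma memLp_cellsResponse_add (ha : 0 < a) {H : Ω × TF → ℂ} {s : ℝ} (hs : s ∈ Set.Ico 0 a)
    (hH : ∀ l ∈ W, MemLp (slice a b H l s) 2 (P.prod (icoMeasure b))) (r : ℤ) :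
    MemLp (fun ω => cellsResponse a b c W (fun z => H (ω, z)) (s + a * r)) 2 P := by
  simp only [cellsResponse_add ha H _ hs]
  exact memLp_finsetSum W fun l hl =>
    (memLp_integral_mul (hH l hl) (memLp_e_mul _ _)).const_mul _

/-- Expand both finite sums and apply `integral_cross` to each pair of cells; pairs in `W × W`
outside `Λ` contribute nothing by `h0`. -/
lemma autocorr_cellsResponse (ha : 0 < a) {Λ : Finset Idx} {H : Ω × TF → ℂ}
    (hW : ∀ j ∈ Λ, j.1 ∈ W ∧ j.2 ∈ W) {s : ℝ × ℝ}
    (hs : s.1 ∈ Set.Ico 0 a) (hs' : s.2 ∈ Set.Ico 0 a)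
    (hH : ∀ l ∈ W, MemLp (slice a b H l s.1) 2 (P.prod (icoMeasure b)))
    (hH' : ∀ l ∈ W, MemLp (slice a b H l s.2) 2 (P.prod (icoMeasure b)))
    (h0 : ∀ j ∉ Λ, ∀ᵐ y ∂((icoMeasure b).prod (icoMeasure b)),
      autocorr P (fun ω z => H (ω, z)) (place a b j (s, y)) = 0) (r r' : ℤ) :
    autocorr P (fun ω => cellsResponse a b c W fun z => H (ω, z)) (s.1 + a * r, s.2 + a * r') =
      responseCorr a b Λ c (autocorr P fun ω z => H (ω, z)) s r r' := by
  have hL : ∀ l ∈ W, ∀ l' ∈ W, Integrable (fun ω =>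
      c ((r - l.1 : ℤ) : ZMod L) *
        (∫ y, e ((y + b * l.2) * (s.1 + a * r)) * slice a b H l s.1 (ω, y) ∂(icoMeasure b)) *
      star (c ((r' - l'.1 : ℤ) : ZMod L) *
        ∫ y, e ((y + b * l'.2) * (s.2 + a * r')) * slice a b H l' s.2 (ω, y) ∂(icoMeasure b)))
      P := fun l hl l' hl' =>
    ((memLp_integral_mul (hH l hl) (memLp_e_mul _ _)).const_mul _).integrable_mul
      ((memLp_integral_mul (hH' l' hl') (memLp_e_mul _ _)).const_mul _).star_two
  have hterm : ∀ l ∈ W, ∀ l' ∈ W, ∫ ω, c ((r - l.1 : ℤ) : ZMod L) *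
        (∫ y, e ((y + b * l.2) * (s.1 + a * r)) * slice a b H l s.1 (ω, y) ∂(icoMeasure b)) *
      star (c ((r' - l'.1 : ℤ) : ZMod L) *
        ∫ y, e ((y + b * l'.2) * (s.2 + a * r')) * slice a b H l' s.2 (ω, y) ∂(icoMeasure b)) ∂P =
      c ((r - l.1 : ℤ) : ZMod L) * star (c ((r' - l'.1 : ℤ) : ZMod L)) *
        ∫ y, e ((y.1 + b * l.2) * (s.1 + a * r) - (y.2 + b * l'.2) * (s.2 + a * r')) *
          autocorr P (fun ω z => H (ω, z)) (place a b (l, l') (s, y))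
          ∂((icoMeasure b).prod (icoMeasure b)) := by
    intro l hl l' hl'
    have h := integral_cross (hH l hl) (hH' l' hl')
      (memLp_e_mul (b := b) (s.1 + a * r) l.2) (memLp_e_mul (b := b) (s.2 + a * r') l'.2)
    simp only [star_e, ← e_add, ← sub_eq_add_neg] at h
    refine Eq.trans ?_ (congrArg (fun v => c ((r - l.1 : ℤ) : ZMod L) *
      star (c ((r' - l'.1 : ℤ) : ZMod L)) * v) h)
    rw [← integral_const_mul]
    congr 1
    ext ω
    rw [star_mul']
    ring
  calc _ = ∑ l ∈ W, ∑ l' ∈ W, ∫ ω, c ((r - l.1 : ℤ) : ZMod L) *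
        (∫ y, e ((y + b * l.2) * (s.1 + a * r)) * slice a b H l s.1 (ω, y) ∂(icoMeasure b)) *
      star (c ((r' - l'.1 : ℤ) : ZMod L) *
        ∫ y, e ((y + b * l'.2) * (s.2 + a * r')) * slice a b H l' s.2 (ω, y)
          ∂(icoMeasure b)) ∂P := by
        simp only [autocorr, cellsResponse_add ha H _ hs, cellsResponse_add ha H _ hs', star_sum,
          Finset.sum_mul_sum]
        rw [integral_finsetSum W fun l hl => integrable_finsetSum W fun l' hl' => hL l hl l' hl']
        exact Finset.sum_congr rfl fun l hl => integral_finsetSum W fun l' hl' => hL l hl l' hl'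
    _ = ∑ j ∈ W ×ˢ W, c ((r - j.1.1 : ℤ) : ZMod L) * star (c ((r' - j.2.1 : ℤ) : ZMod L)) *
        ∫ y, e ((y.1 + b * j.1.2) * (s.1 + a * r) - (y.2 + b * j.2.2) * (s.2 + a * r')) *
          autocorr P (fun ω z => H (ω, z)) (place a b j (s, y))
          ∂((icoMeasure b).prod (icoMeasure b)) := by
        rw [Finset.sum_product]
        exact Finset.sum_congr rfl fun l hl => Finset.sum_congr rfl fun l' hl' =>
          hterm l hl l' hl'
    _ = _ := by
        refine (Finset.sum_subset (fun j hj => Finset.mem_product.2 (hW j hj))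
          fun j _ hj => ?_).symm
        rw [integral_eq_zero_of_ae, mul_zero]
        filter_upwards [h0 j hj] with y hy
        rw [hy, mul_zero, Pi.zero_apply]

end Response

/-! ### From the autocorrelation to paths, and independence of the version of the response -/

section Assembly

variable {Ω : Type*} [MeasurableSpace Ω] {P : Measure Ω} {a b : ℝ} {L : ℕ} {Λ : Finset Idx}
  {c : ZMod L → ℂ} {W : Finset (ℤ × ℤ)}

lemma notMem_cover_of_mem_cell (ha : 0 < a) (hb : 0 < b) {j : Idx} (hj : j ∉ Λ) {q : TF × TF}
    (hq : q ∈ cell a b j) : q ∉ cover a b Λ := by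
  intro h
  simp only [cover, Set.mem_iUnion] at h
  obtain ⟨j', hj', hq'⟩ := h
  exact hj (cell_injective ha hb hq hq' ▸ hj')

lemma place_mem_cell {j : Idx} {x : (ℝ × ℝ) × (ℝ × ℝ)} (hx : x ∈ box a b) :
    place a b j x ∈ cell a b j := by
  rw [← unplace_mem_box]
  simpa [place, unplace] using hx

/-- The process vanishes off the cells `l` with `(l, l) ∈ Λ`. -/
lemma ae_eq_zero_off_cells [SFinite P] (ha : 0 < a) (hb : 0 < b)
    (hW : ∀ j ∈ Λ, j.1 ∈ W ∧ j.2 ∈ W) {H : Ω × TF → ℂ} (hH : MemLp H 2 (P.prod volume))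
    (h0 : ∀ᵐ q : TF × TF, q ∉ cover a b Λ → autocorr P (fun ω z => H (ω, z)) q = 0) :
    ∀ᵐ ω ∂P, ∀ᵐ z : TF, (⌊z.1 / a⌋, ⌊z.2 / b⌋) ∉ W → H (ω, z) = 0 := by
  have h1 : ∀ l : ℤ × ℤ, ∀ᵐ ω ∂P, ∀ᵐ z : TF, l ∉ W → z ∈ tfCell a b l → H (ω, z) = 0 := by
    intro l
    by_cases hl : l ∈ W
    · exact ae_of_all _ fun ω => ae_of_all _ fun z h => absurd hl h
    have hHl : MemLp H 2 (P.prod (volume.restrict (tfCell a b l))) :=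
      hH.mono_measure (Measure.prod_mono le_rfl Measure.restrict_le_self)
    have hl0 : ∀ᵐ q ∂((volume.restrict (tfCell a b l)).prod (volume.restrict (tfCell a b l))),
        ∫ ω, H (ω, q.1) * star (H (ω, q.2)) ∂P = 0 := by
      rw [Measure.prod_restrict, ae_restrict_iff'
        ((measurableSet_tfCell a b l).prod (measurableSet_tfCell a b l))]
      filter_upwards [h0] with q hq hmem
      -- As `W` contains the projections of `Λ`, `l ∉ W` gives `(l, l) ∉ Λ`: the diagonal block lies
      -- outside the cover.
      exact hq (notMem_cover_of_mem_cell ha hb (j := (l, l))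
        (fun hj => hl (hW _ hj).1) ⟨hmem.1, hmem.2⟩)
    filter_upwards [ae_eq_zero_of_autocorr hHl hl0] with ω hω
    rw [ae_restrict_iff' (measurableSet_tfCell a b l)] at hω
    filter_upwards [hω] with z hz _ hmem
    exact hz hmem
  filter_upwards [ae_all_iff.2 h1] with ω hω
  filter_upwards [ae_all_iff.2 hω] with z hz hW'
  exact hz _ hW' ((mem_tfCell_iff ha hb).2 rfl)

/-- Weak uniqueness holds path by path; exchanging "almost every `ω`" and "almost every `x`"
requires a jointly measurable set, hence the strongly measurable representatives. -/
lemma IsStochResponse.ae_eq [SFinite P] {η : Ω → TF → ℂ} {u : Functional} {f g : Ω → ℝ → ℂ}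
    (hf : IsStochResponse P η u f) (hg : IsStochResponse P η u g) :
    ∀ᵐ x : ℝ, ∀ᵐ ω ∂P, f ω x = g ω x := by
  have h1 : ∀ᵐ ω ∂P, ∀ᵐ x : ℝ, hf.measurable.mk _ (ω, x) = hg.measurable.mk _ (ω, x) := by
    filter_upwards [hf.response, hg.response, Measure.ae_ae_of_ae_prod hf.measurable.ae_eq_mk,
      Measure.ae_ae_of_ae_prod hg.measurable.ae_eq_mk] with ω h2 h3 h4 h5
    filter_upwards [h2.ae_eq h3, h4, h5] with x h6 h7 h8
    rw [← h7, ← h8, h6]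
  have h2 : (fun q : Ω × ℝ => f q.1 q.2) =ᵐ[P.prod volume] fun q => g q.1 q.2 :=
    hf.measurable.ae_eq_mk.trans (EventuallyEq.trans ((Measure.ae_prod_iff_ae_ae
      (measurableSet_eq_fun hf.measurable.stronglyMeasurable_mk.measurable
        hg.measurable.stronglyMeasurable_mk.measurable)).2 h1) hg.measurable.ae_eq_mk.symm)
  exact ae_ae_swap_eq h2

lemma ae_forall_translate {p : ℝ → Prop} (h : ∀ᵐ x : ℝ, p x) (a : ℝ) :
    ∀ᵐ x : ℝ, ∀ k : ℤ, p (x + a * k) :=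
  ae_all_iff.2 fun k => (measurePreserving_add_right volume (a * (k : ℝ))).quasiMeasurePreserving.ae h

lemma isStochResponse_cells [SFinite P] (ha : 0 < a) (hb : 0 < b)
    (hW : ∀ j ∈ Λ, j.1 ∈ W ∧ j.2 ∈ W) {η : Ω → TF → ℂ} {H : Ω × TF → ℂ}
    (hHm : StronglyMeasurable H) (hH : MemLp H 2 (P.prod volume))
    (hη : (fun q : Ω × TF => η q.1 q.2) =ᵐ[P.prod volume] H)
    (h0 : ∀ᵐ q : TF × TF, q ∉ cover a b Λ → autocorr P (fun ω z => H (ω, z)) q = 0) :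
    IsStochResponse P η (deltaTrain a c) fun ω => cellsResponse a b c W fun z => H (ω, z) := by
  refine ⟨(stronglyMeasurable_cellsResponse hHm).aestronglyMeasurable, ?_⟩
  filter_upwards [ae_eq_zero_off_cells ha hb hW hH h0, ae_memLp_right hH,
    Measure.ae_ae_of_ae_prod hη] with ω h1 h2 h3
  refine (isResponse_cells ha hb h2 h1 c).congr_ae ?_
  filter_upwards [h3] with z hz using hz.symm

lemma ae_memLp_cellsResponse [SFinite P] (ha : 0 < a) {H : Ω × TF → ℂ}
    (hH : MemLp H 2 (P.prod volume)) :
    ∀ᵐ x : ℝ, MemLp (fun ω => cellsResponse a b c W (fun z => H (ω, z)) x) 2 P := by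
  filter_upwards [ae_forall_translate ((ae_ball_iff W.countable_toSet).2 fun l _ =>
    ae_memLp_slice (b := b) hH l) a] with x hx
  have h1 := Int.floor_le (x / a)
  have h2 := Int.lt_floor_add_one (x / a)
  rw [le_div_iff₀ ha] at h1
  rw [div_lt_iff₀ ha] at h2
  have hs : x + a * ((-⌊x / a⌋ : ℤ) : ℝ) ∈ Set.Ico 0 a := by
    push_cast
    constructor <;> nlinarith
  have h3 := memLp_cellsResponse_add (c := c) ha hs (fun l hl => hx (-⌊x / a⌋) l hl) ⌊x / a⌋
  have h4 : x + a * ((-⌊x / a⌋ : ℤ) : ℝ) + a * ⌊x / a⌋ = x := by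
    push_cast
    ring
  rwa [h4] at h3

/-- The response is known only at almost every `x`, but the formula samples it along `s + a ℤ`;
countably many translates keep the exceptional set of `s` null. -/
lemma ae_responseCorr [SFinite P] (ha : 0 < a) (hb : 0 < b)
    (hW : ∀ j ∈ Λ, j.1 ∈ W ∧ j.2 ∈ W) {H : Ω × TF → ℂ} (hH : MemLp H 2 (P.prod volume))
    (h0 : ∀ᵐ q : TF × TF, q ∉ cover a b Λ → autocorr P (fun ω z => H (ω, z)) q = 0)
    {f : Ω → ℝ → ℂ}
    (hf : ∀ᵐ x : ℝ, ∀ᵐ ω ∂P, f ω x = cellsResponse a b c W (fun z => H (ω, z)) x) :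
    ∀ᵐ s ∂((icoMeasure a).prod (icoMeasure a)), ∀ r r' : ℤ,
      autocorr P f (s.1 + a * r, s.2 + a * r') =
        responseCorr a b Λ c (autocorr P fun ω z => H (ω, z)) s r r' := by
  have hslice : ∀ᵐ s ∂(icoMeasure a), (∀ l ∈ W, MemLp (slice a b H l s) 2 (P.prod (icoMeasure b)))
      ∧ (∀ k : ℤ, ∀ᵐ ω ∂P, f ω (s + a * k) =
        cellsResponse a b c W (fun z => H (ω, z)) (s + a * k)) ∧ s ∈ Set.Ico 0 a := by
    filter_upwards [ae_restrict_of_ae ((ae_ball_iff W.countable_toSet).2 fun l _ =>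
      ae_memLp_slice (b := b) hH l), ae_restrict_of_ae (ae_forall_translate hf a),
      ae_restrict_mem measurableSet_Ico] with s h1 h2 h3 using ⟨h1, h2, h3⟩
  have hcell : ∀ᵐ s ∂((icoMeasure a).prod (icoMeasure a)), ∀ j ∉ Λ,
      ∀ᵐ y ∂((icoMeasure b).prod (icoMeasure b)),
        autocorr P (fun ω z => H (ω, z)) (place a b j (s, y)) = 0 := by
    refine ae_all_iff.2 fun j => ?_
    by_cases hj : j ∈ Λ
    · exact ae_of_all _ fun s h => absurd hj h
    have h1 : ∀ᵐ x ∂(volume.restrict (box a b)),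
        autocorr P (fun ω z => H (ω, z)) (place a b j x) = 0 := by
      rw [ae_restrict_iff' (measurableSet_box a b)]
      filter_upwards [(measurePreserving_place a b j).quasiMeasurePreserving.ae h0] with x hx hmem
      exact hx (notMem_cover_of_mem_cell ha hb hj (place_mem_cell hmem))
    rw [volume_restrict_box] at h1
    filter_upwards [Measure.ae_ae_of_ae_prod h1] with s hs _ using hs
  filter_upwards [Measure.quasiMeasurePreserving_fst.ae hslice,
    Measure.quasiMeasurePreserving_snd.ae hslice, hcell] with s h1 h2 h3 r r'
  rw [autocorr_congr (h1.2.1 r) (h2.2.1 r')]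
  exact autocorr_cellsResponse ha hW h1.2.2 h2.2.2 h1.1 h2.1 h3 r r'

end Assembly

end

end OpSampling

open OpSampling
theorem mainTheorem2 {Ω : Type*} [MeasurableSpace Ω] (P : Measure Ω) [IsProbabilityMeasure P]
    (a b : ℝ) (L : ℕ) [NeZero L] (Λ : Finset Idx) (U : Set (TF × TF))
    (hU : IsSymmRectified a b L Λ U)
    (c : ZMod L → ℂ) (A : Matrix Λ (ZMod L × ZMod L) ℂ) (hA : A * gaborTensor c Λ = 1)
    (η : Ω → TF → ℂ) (hη : η ∈ StOPW P U) :
    (∃ f : Ω → ℝ → ℂ, IsStochResponse P η (deltaTrain a c) f) ∧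
    ∀ f : Ω → ℝ → ℂ, IsStochResponse P η (deltaTrain a c) f →
      (∀ᵐ x : ℝ, MemLp (fun ω => f ω x) 2 P) ∧
      Tendsto
        (fun F : Finset (ℤ × ℤ) =>
          eLpNorm (fun q : TF × TF =>
            autocorr P η q - reconPartial a b Λ A (autocorr P f) F q) 2 volume)
        atTop (𝓝 0) := by
  obtain ⟨hSt, -, hsupp⟩ := hη
  -- A strongly measurable representative makes the explicit response jointly measurable;
  -- autocorrelations change only on a null set.
  obtain ⟨H, hHm, hηH⟩ := hSt.memLp.1
  have hH : MemLp H 2 (P.prod volume) := (memLp_congr_ae hηH).1 hSt.memLp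
  have hR : autocorr P η =ᵐ[volume] autocorr P fun ω z => H (ω, z) := autocorr_ae_eq hηH
  have h0 : ∀ᵐ q : TF × TF, q ∉ cover a b Λ → autocorr P (fun ω z => H (ω, z)) q = 0 := by
    filter_upwards [hsupp, hR] with q h1 h2 h3
    rw [← h2, h1 fun h => h3 (hU.subset h)]
  obtain ⟨W, hW⟩ : ∃ W : Finset (ℤ × ℤ), ∀ j ∈ Λ, j.1 ∈ W ∧ j.2 ∈ W :=
    ⟨Λ.image Prod.fst ∪ Λ.image Prod.snd, fun j hj =>
      ⟨Finset.mem_union_left _ (Finset.mem_image_of_mem _ hj),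
        Finset.mem_union_right _ (Finset.mem_image_of_mem _ hj)⟩⟩
  have hresp := isStochResponse_cells (c := c) hU.a_pos hU.b_pos hW hHm hH hηH h0
  refine ⟨⟨_, hresp⟩, fun f hf => ⟨?_, ?_⟩⟩
  · filter_upwards [hf.ae_eq hresp, ae_memLp_cellsResponse hU.a_pos hH] with x h1 h2
    exact (memLp_congr_ae h1).2 h2
  · refine (tendsto_reconPartial hU.a_pos hU.b_pos hU.area hA (memLp_cross hH hH) h0
      (ae_responseCorr hU.a_pos hU.b_pos hW hH h0 (hf.ae_eq hresp))).congr fun F => ?_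
    refine eLpNorm_congr_ae ?_
    filter_upwards [hR] with q hq
    rw [hq]
    rfl
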